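/- Consider a FCFS M/G/1 queue: customers arrive at the times $T_1<T_2<\dots$ of a Poisson process with rate $\lambda>0$, and their service requirements $B_1,B_2,\dots$ are i.i.d. nonnegative random variables, independent of the arrivals, with $\mu_k=\mathbb E B_1^k$ and $\lambda\mu_1<1$. Let $J(t)=\sum_{n:\,T_n\le t}B_n$ and, for $w\ge 0$, let $W_w(t)=X_w(t)+\sup_{0\le s\le t}\max(-X_w(s),0)$ with $X_w(t)=w+J(t)-t$ be the workload at time $t$ when the initial workload is $w$. For fixed $v\ge 0$ define the externalities process $$E_v(x)=\sum_{n=1}^\infty\bigl[W_{v+x}(T_n)-W_v(T_n)\bigr],\qquad x\ge 0 .$$ Let $N(s)$ be the probability that exactly $s$ customers are served during the first busy period of the queue started empty, and let $\eta_k=\sum_{s\ge1}s^kN(s)\in[0,\infty]$. For every $x\ge0$ the series defining $E_v(x)$ converges almost surely, $\eta_1<\infty$, $E_v(x)$ is integrable, and $$\mathbb E[E_v(x)]=\lambda x\Bigl(v+\frac x2\Bigr)\eta_1,\qquad \operatorname{Var}[E_v(x)]=\lambda x^2\Bigl(v+\frac x3\Bigr)\eta_2,$$ where the second identity holds in $[0,\infty]$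 (with $0\cdot\infty=0$). If moreover $\mu_2<\infty$, then $\eta_2<\infty$, the variables $E_v(x)$ are square integrable, and for all $x_1,x_2\ge0$ $$\operatorname{Cov}[E_v(x_1+x_2),E_v(x_1)]=\frac{\lambda\eta_2}{6}\bigl(2x_1^3+6vx_1^2+3x_1^2x_2+6vx_1x_2\bigr).$$ If in addition $x_1>0$, then both variances are positive and $$\operatorname{Corr}[E_v(x_1+x_2),E_v(x_1)]=\frac{2x_1^3+6vx_1^2+3x_1^2x_2+6vx_1x_2}{6x_1(x_1+x_2)\sqrt{\left(v+\frac{x_1}{3}\right)\left(v+\frac{x_1+x_2}{3}\right)}} .$$ Consequently, the auto-correlation does not depend on $\lambda$ or on the service distribution: it takes the same value for any two such queues (with $\lambda\mu_1<1$ and $\mu_2<\infty$) and the same $v,x_1,x_2$. -/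

import Mathlib

open MeasureTheory ProbabilityTheory
open scoped ENNReal

namespace MG1

/-! ### Deterministic path functionals

`a n` is the time between the `n`-th and the `(n+1)`-st arrival (with `a 0` the time until the first
arrival) and `b n` is the service requirement of the `(n+1)`-st arriving customer. -/

/-- The arrival time of the `(n+1)`-st customer. -/
noncomputable def arrivalTime (a : ℕ → ℝ) (n : ℕ) : ℝ :=
  ∑ i ∈ Finset.range (n + 1), a i

/-- The total service requirement `J(t)` of all customers who arrive up to time `t`. -/
noncomputable def totalInput (a b : ℕ → ℝ) (t : ℝ) : ℝ :=
  ∑' n : ℕ, if arrivalTime a n ≤ t then b n else 0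

/-- The free process `v + J(t) - t`. -/
noncomputable def freeProcess (a b : ℕ → ℝ) (v t : ℝ) : ℝ :=
  v + totalInput a b t - t

/-- The (one-sided, Skorokhod) reflection at the origin of a path on `[0, ∞)`:
`X(t) + sup_{0 ≤ s ≤ t} max (-X(s)) 0`. -/
noncomputable def reflection (X : ℝ → ℝ) (t : ℝ) : ℝ :=
  X t + sSup ((fun s => max (-X s) 0) '' Set.Icc 0 t)

/-- The workload at time `t` when the initial workload is `v`. -/
noncomputable def workload (a b : ℕ → ℝ) (v t : ℝ) : ℝ :=
  reflection (freeProcess a b v) t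

/-- The contribution of the `(n+1)`-st customer to the externality: the difference, at the arrival
time of this customer, of the workloads with initial values `v + x` and `v`. -/
noncomputable def externalityTerm (a b : ℕ → ℝ) (v x : ℝ) (n : ℕ) : ℝ :=
  workload a b (v + x) (arrivalTime a n) - workload a b v (arrivalTime a n)

/-- The end of the first busy period of a system which starts empty: the first time, from the first
arrival on, at which the workload is zero. -/
noncomputable def firstBusyPeriodEnd (a b : ℕ → ℝ) : ℝ :=
  sInf {t : ℝ | arrivalTime a 0 ≤ t ∧ workload a b 0 t = 0}

/-- The number of customers who arrive during the first busy period (the one who opens it included)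
of a system which starts empty. -/
noncomputable def firstBusyPeriodCount (a b : ℕ → ℝ) : ℕ∞ :=
  Set.encard {n : ℕ | arrivalTime a n ∈ Set.Icc (arrivalTime a 0) (firstBusyPeriodEnd a b)}

/-! ### The stochastic model -/

variable {Ω : Type*} [MeasurableSpace Ω]

/-- The `k`-th moment of the service distribution, as an extended nonnegative number. -/
noncomputable def serviceMoment (ν : Measure ℝ) (k : ℕ) : ℝ≥0∞ :=
  ∫⁻ t, ENNReal.ofReal t ^ k ∂ν

/-- The input of a stable M/G/1 queue with arrival rate `rate` and service distribution `ν`: the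
interarrival times `A n` are exponential with parameter `rate` (so customers arrive according to a
Poisson process), the service requirements `B n` have the law `ν` on `[0, ∞)`, all these variables
are independent, and the load is less than one. -/
structure IsStableInput (P : Measure Ω) (rate : ℝ) (ν : Measure ℝ) (A B : ℕ → Ω → ℝ) : Prop where
  rate_pos : 0 < rate
  measurable_interarrival : ∀ n, Measurable (A n)
  measurable_service : ∀ n, Measurable (B n)
  law_interarrival : ∀ n, P.map (A n) = expMeasure rate
  law_service : ∀ n, P.map (B n) = ν
  service_nonneg : ν (Set.Iio 0) = 0
  indep : iIndepFun (Sum.elim A B) P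
  load_lt_one : ENNReal.ofReal rate * serviceMoment ν 1 < 1

/-- The externality `E_v(x)` as a random variable: the total waiting time of the other customers
which would be saved if a customer of size `x`, who arrives at time `0` and finds the workload `v`,
reduced the service requirement to zero. -/
noncomputable def externality (A B : ℕ → Ω → ℝ) (v x : ℝ) (ω : Ω) : ℝ :=
  ∑' n : ℕ, externalityTerm (fun i => A i ω) (fun i => B i ω) v x n

/-- The probability `N(s)` that exactly `s` customers receive service during the first busy period
of the queue started empty. -/
noncomputable def busyPeriodProb (P : Measure Ω) (A B : ℕ → Ω → ℝ) (s : ℕ) : ℝ≥0∞ :=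
  P {ω | firstBusyPeriodCount (fun i => A i ω) (fun i => B i ω) = (s : ℕ∞)}

/-- The `k`-th moment `η_k = ∑_{s ≥ 1} s ^ k N(s)` of the number of customers in a busy period. -/
noncomputable def busyPeriodMoment (P : Measure Ω) (A B : ℕ → Ω → ℝ) (k : ℕ) : ℝ≥0∞ :=
  ∑' s : ℕ, ((s + 1 : ℕ) : ℝ≥0∞) ^ k * busyPeriodProb P A B (s + 1)

/-- The correlation coefficient of two real random variables. -/
noncomputable def correlation (X Y : Ω → ℝ) (P : Measure Ω) : ℝ :=
  covariance X Y P / (√(variance X P) * √(variance Y P))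

end MG1

/-! Let `walk n` be the arrival time of customer `n` minus the work brought by customers `0, ..., n
- 1`, that is, the net time `t - J(t)` just before that arrival. By Skorokhod reflection the
workload at the `n`-th arrival is `max w R_n` minus a quantity free of the initial workload `w`,
where `R_n` is the running maximum of the walk. A term of the externality is therefore the length of
the set of levels `u` in `(v, v + x]` with `R_n ≤ u`. Summing over `n` with Tonelli, `E_v(x)` is the
integral of `passage u` over `u` in `(v, v + x]`, where `passage u` is the first index at which the
walk exceeds `u`.

Because interarrival times are memoryless, `u ↦ passage u` behaves as a compound Poisson process:
jumps occur at rate `r`, and each is distributed as the number of customers in a busy period. So its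
mean is `r η₁ u` and its covariance is `r η₂ min u w`. Integrating over levels gives all the
formulas, and the common factor `r η₂` cancels in the correlation.

Only moments are needed, so no process is constructed. `lintegral_passage_add` supplies stationary
independent increments. Splitting off the first customer then gives renewal equations for the first
two moments. Polynomials solve these equations (`lintegral_expMeasure_poly`), and
`renewal_comparison` gives uniqueness among locally bounded solutions. The local bounds come from
truncated passage indices (`lintegral_sum_below_le`, `lintegral_sum_below_sq_le`); this is where
load below one enters. `busyMoment_two_ne_top_iff` links `η₂ < ∞` to `μ₂ < ∞`, and
`passageMoment_two_eq_top` covers the variance identity when `η₂ = ∞`. -/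

namespace MG1

/-! ### The embedded random walk and its passage index -/

/-- The embedded random walk of an input `z`, where `z (.inl n)` are the interarrival times and
`z (.inr n)` the service requirements. -/
noncomputable def walk (z : ℕ ⊕ ℕ → ℝ) (n : ℕ) : ℝ :=
  ∑ i ∈ Finset.range (n + 1), z (.inl i) - ∑ i ∈ Finset.range n, z (.inr i)

/-- The walk does not exceed the level `u` up to time `n`. -/
def StaysBelow (u : ℝ) (z : ℕ ⊕ ℕ → ℝ) (n : ℕ) : Prop := ∀ k ≤ n, walk z k ≤ u

open scoped Classical in
/-- The indicator of `StaysBelow`. -/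
noncomputable def below (u : ℝ) (z : ℕ ⊕ ℕ → ℝ) (n : ℕ) : ℝ≥0∞ := if StaysBelow u z n then 1 else 0

/-- The first time at which the walk exceeds the level `u`. -/
noncomputable def passage (u : ℝ) (z : ℕ ⊕ ℕ → ℝ) : ℝ≥0∞ := ∑' n, below u z n

/-- The input which starts with the pair `(p.1, p.2.1)` and continues with `p.2.2`. -/
def consInput (p : ℝ × ℝ × (ℕ ⊕ ℕ → ℝ)) : ℕ ⊕ ℕ → ℝ
  | .inl 0 => p.1
  | .inl (n + 1) => p.2.2 (.inl n)
  | .inr 0 => p.2.1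
  | .inr (n + 1) => p.2.2 (.inr n)

lemma walk_consInput_zero (p : ℝ × ℝ × (ℕ ⊕ ℕ → ℝ)) : walk (consInput p) 0 = p.1 := by
  simp [walk, consInput]

lemma walk_consInput_succ (p : ℝ × ℝ × (ℕ ⊕ ℕ → ℝ)) (n : ℕ) :
    walk (consInput p) (n + 1) = walk p.2.2 n + p.1 - p.2.1 := by
  have h1 : ∑ i ∈ Finset.range (n + 1 + 1), consInput p (.inl i)
      = ∑ i ∈ Finset.range (n + 1), p.2.2 (.inl i) + p.1 := Finset.sum_range_succ' _ _
  have h2 : ∑ i ∈ Finset.range (n + 1), consInput p (.inr i)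
      = ∑ i ∈ Finset.range n, p.2.2 (.inr i) + p.2.1 := Finset.sum_range_succ' _ _
  rw [walk, h1, h2, walk]
  ring

lemma staysBelow_consInput_zero {u : ℝ} {p : ℝ × ℝ × (ℕ ⊕ ℕ → ℝ)} :
    StaysBelow u (consInput p) 0 ↔ p.1 ≤ u := by
  simp [StaysBelow, walk_consInput_zero]

lemma staysBelow_consInput_succ {u : ℝ} {p : ℝ × ℝ × (ℕ ⊕ ℕ → ℝ)} {n : ℕ} :
    StaysBelow u (consInput p) (n + 1) ↔ p.1 ≤ u ∧ StaysBelow (u - p.1 + p.2.1) p.2.2 n := by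
  constructor
  · intro h
    refine ⟨by simpa [walk_consInput_zero] using h 0 (by omega), fun k hk => ?_⟩
    have := h (k + 1) (by omega)
    rw [walk_consInput_succ] at this
    linarith
  · rintro ⟨h0, h⟩ (_ | k) hk
    · rwa [walk_consInput_zero]
    · have := h k (by omega)
      rw [walk_consInput_succ]
      linarith

lemma staysBelow_antitone {u : ℝ} {z : ℕ ⊕ ℕ → ℝ} {m n : ℕ} (h : m ≤ n) (hn : StaysBelow u z n) :
    StaysBelow u z m := fun k hk => hn k (hk.trans h)

lemma below_consInput_zero (u : ℝ) (p : ℝ × ℝ × (ℕ ⊕ ℕ → ℝ)) :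
    below u (consInput p) 0 = if p.1 ≤ u then 1 else 0 := by
  simp [below, staysBelow_consInput_zero]

lemma below_consInput_succ (u : ℝ) (p : ℝ × ℝ × (ℕ ⊕ ℕ → ℝ)) (n : ℕ) :
    below u (consInput p) (n + 1)
      = if p.1 ≤ u then below (u - p.1 + p.2.1) p.2.2 n else 0 := by
  unfold below
  by_cases h1 : p.1 ≤ u <;> by_cases h2 : StaysBelow (u - p.1 + p.2.1) p.2.2 n <;>
    simp [staysBelow_consInput_succ, h1, h2]

/-- First-customer decomposition: an arrival within `u` uses up `a` of the level and gives back its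
service `b`, after which the walk starts anew. All recursions below come from this one. -/
lemma passage_consInput (u : ℝ) (p : ℝ × ℝ × (ℕ ⊕ ℕ → ℝ)) :
    passage u (consInput p)
      = if p.1 ≤ u then 1 + passage (u - p.1 + p.2.1) p.2.2 else 0 := by
  rw [passage, tsum_eq_zero_add' ENNReal.summable]
  simp only [below_consInput_zero, below_consInput_succ]
  split_ifs <;> simp [passage]

lemma sum_below_consInput (N : ℕ) (u : ℝ) (p : ℝ × ℝ × (ℕ ⊕ ℕ → ℝ)) :
    ∑ n ∈ Finset.range (N + 1), below u (consInput p) n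
      = if p.1 ≤ u then 1 + ∑ n ∈ Finset.range N, below (u - p.1 + p.2.1) p.2.2 n else 0 := by
  rw [Finset.sum_range_succ']
  simp only [below_consInput_zero, below_consInput_succ]
  split_ifs <;> simp [add_comm]

/-- A finite passage index is attained. -/
lemma passage_eq_of_not_staysBelow {u : ℝ} {z : ℕ ⊕ ℕ → ℝ} {n : ℕ}
    (h : ∀ k < n, StaysBelow u z k) (hn : ¬ StaysBelow u z n) : passage u z = n := by
  rw [passage, tsum_eq_sum (s := Finset.range n)]
  · rw [Finset.sum_congr rfl (g := fun _ => 1)]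
    · simp
    · intro k hk
      simp [below, h k (Finset.mem_range.1 hk)]
  · intro k hk
    have : ¬ StaysBelow u z k := fun h' => hn (staysBelow_antitone (by simpa using hk) h')
    simp [below, this]

lemma exists_not_staysBelow {u : ℝ} {z : ℕ ⊕ ℕ → ℝ} (h : passage u z ≠ ∞) :
    ∃ n, ¬ StaysBelow u z n := by
  by_contra! hc
  apply h
  simp [passage, below, hc]

open scoped Classical in
lemma passage_eq_find {u : ℝ} {z : ℕ ⊕ ℕ → ℝ} (h : ∃ n, ¬ StaysBelow u z n) :
    passage u z = (Nat.find h : ℕ) :=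
  passage_eq_of_not_staysBelow (fun _ hk => not_not.1 (Nat.find_min h hk)) (Nat.find_spec h)

lemma passage_eq_natCast_or_top (u : ℝ) (z : ℕ ⊕ ℕ → ℝ) :
    passage u z = ∞ ∨ ∃ n : ℕ, passage u z = n := by
  by_cases h : passage u z = ∞
  · exact .inl h
  · exact .inr ⟨_, passage_eq_find (exists_not_staysBelow h)⟩

/-! ### Path functionals in terms of the walk -/

section Paths

variable {a b : ℕ → ℝ}

lemma arrivalTime_strictMono (ha : ∀ n, 0 < a n) : StrictMono (arrivalTime a) := by
  refine strictMono_nat_of_lt_succ fun n => ?_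
  rw [arrivalTime, arrivalTime, Finset.sum_range_succ _ (n + 1)]
  linarith [ha (n + 1)]

lemma arrivalTime_pos (ha : ∀ n, 0 < a n) (n : ℕ) : 0 < arrivalTime a n :=
  Finset.sum_pos (fun i _ => ha i) ⟨0, by simp⟩

lemma walk_eq (a b : ℕ → ℝ) (n : ℕ) :
    walk (Sum.elim a b) n = arrivalTime a n - ∑ j ∈ Finset.range n, b j := rfl

lemma totalInput_eq_sum (ha : ∀ n, 0 < a n) {s : ℝ} {n : ℕ} (hs : s < arrivalTime a n) :
    totalInput a b s = ∑ j ∈ Finset.range n, if arrivalTime a j ≤ s then b j else 0 := by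
  refine tsum_eq_sum fun j hj => if_neg ?_
  have := (arrivalTime_strictMono ha).monotone (not_lt.1 (fun h => hj (Finset.mem_range.2 h)))
  linarith

lemma totalInput_le (ha : ∀ n, 0 < a n) (hb : ∀ n, 0 ≤ b n) {s : ℝ} {n : ℕ}
    (hs : s < arrivalTime a n) : totalInput a b s ≤ ∑ j ∈ Finset.range n, b j := by
  rw [totalInput_eq_sum ha hs]
  refine Finset.sum_le_sum fun j _ => ?_
  split_ifs
  · exact le_rfl
  · exact hb j

lemma totalInput_nonneg (hb : ∀ n, 0 ≤ b n) (s : ℝ) : 0 ≤ totalInput a b s :=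
  tsum_nonneg fun n => by split_ifs <;> simp [hb]

lemma le_totalInput (ha : ∀ n, 0 < a n) (hb : ∀ n, 0 ≤ b n) {s : ℝ} {m n : ℕ}
    (hs : s < arrivalTime a n) (hm : ∀ j < m, arrivalTime a j ≤ s) :
    ∑ j ∈ Finset.range m, b j ≤ totalInput a b s := by
  have hmn : m ≤ n := by
    by_contra! h
    linarith [hm n h]
  rw [totalInput_eq_sum ha hs]
  calc ∑ j ∈ Finset.range m, b j
      = ∑ j ∈ Finset.range m, if arrivalTime a j ≤ s then b j else 0 :=
        Finset.sum_congr rfl fun j hj => (if_pos (hm j (Finset.mem_range.1 hj))).symm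
    _ ≤ _ := Finset.sum_le_sum_of_subset_of_nonneg (by simpa using hmn)
        fun j _ _ => by split_ifs <;> simp [hb]

lemma workload_eq (w t : ℝ) :
    workload a b w t = w - (t - totalInput a b t)
      + sSup ((fun s => max (s - totalInput a b s - w) 0) '' Set.Icc 0 t) := by
  have h : (fun s => max (-(w + totalInput a b s - s)) 0)
      = fun s => max (s - totalInput a b s - w) 0 := by
    funext s
    ring_nf
  simp only [workload, reflection, freeProcess]
  rw [h]
  ring

lemma bddAbove_netTime (hb : ∀ n, 0 ≤ b n) (w t : ℝ) :
    BddAbove ((fun s => max (s - totalInput a b s - w) 0) '' Set.Icc 0 t) := by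
  refine ⟨max (t - w) 0, ?_⟩
  rintro _ ⟨s, hs, rfl⟩
  have := totalInput_nonneg (a := a) hb s
  exact max_le_max (by linarith [hs.2]) le_rfl

/-- Between arrivals net time grows with slope one, and at arrivals it drops. Its supremum is thus
governed by its left limits at arrivals, which are the values of the walk; here `k` is the next
arrival at or after `s`. -/
lemma exists_netTime_le_walk (ha : ∀ n, 0 < a n) (hb : ∀ n, 0 ≤ b n) {s : ℝ} {n : ℕ}
    (hs : s ≤ arrivalTime a n) :
    ∃ k ≤ n, (∀ j < k, arrivalTime a j < s) ∧ s ≤ arrivalTime a k ∧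
      s - totalInput a b s ≤ s - ∑ j ∈ Finset.range k, b j := by
  classical
  have hex : ∃ k, s ≤ arrivalTime a k := ⟨n, hs⟩
  have hlt : ∀ j < Nat.find hex, arrivalTime a j < s := fun j hj => not_le.1 (Nat.find_min hex hj)
  refine ⟨Nat.find hex, Nat.find_min' hex hs, hlt, Nat.find_spec hex, ?_⟩
  have := le_totalInput ha hb (n := n + 1)
    (hs.trans_lt (arrivalTime_strictMono ha n.lt_succ_self)) fun j hj => (hlt j hj).le
  linarith

lemma sSup_netTime_le_iff (ha : ∀ n, 0 < a n) (hb : ∀ n, 0 ≤ b n) {w c : ℝ} (hc : 0 ≤ c) (n : ℕ) :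
    sSup ((fun s => max (s - totalInput a b s - w) 0) '' Set.Icc 0 (arrivalTime a n)) ≤ c
      ↔ StaysBelow (w + c) (Sum.elim a b) n := by
  constructor
  · intro h k hk
    rw [walk_eq]
    refine le_of_forall_lt_imp_le_of_dense fun r hr => ?_
    -- The walk value is only a left limit of net time, hence the approximation from below. This `s`
    -- lies before arrival `k`, so at most the first `k` services have entered, and its net time is
    -- at least `r`.
    set s := max 0 (r + ∑ j ∈ Finset.range k, b j) with hsdef
    have hsk : s < arrivalTime a k := max_lt (arrivalTime_pos ha k) (by linarith)
    have hkn := (arrivalTime_strictMono ha).monotone hk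
    have h1 := (le_csSup (bddAbove_netTime hb w (arrivalTime a n))
      ⟨s, ⟨le_max_left _ _, by linarith⟩, rfl⟩).trans h
    have h2 := (le_max_left _ _).trans h1
    have h3 := totalInput_le ha hb hsk
    have h4 : r + ∑ j ∈ Finset.range k, b j ≤ s := le_max_right _ _
    linarith
  · intro h
    refine csSup_le ⟨_, 0, ⟨le_rfl, (arrivalTime_pos ha n).le⟩, rfl⟩ ?_
    rintro _ ⟨s, hs, rfl⟩
    refine max_le ?_ hc
    obtain ⟨k, hk, -, h1, h2⟩ := exists_netTime_le_walk ha hb hs.2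
    have := h k hk
    rw [walk_eq] at this
    linarith

lemma sSup_netTime_nonneg (hb : ∀ n, 0 ≤ b n) {w t : ℝ} (ht : 0 ≤ t) :
    0 ≤ sSup ((fun s => max (s - totalInput a b s - w) 0) '' Set.Icc 0 t) :=
  (le_max_right _ _).trans (le_csSup (bddAbove_netTime hb w t) ⟨0, ⟨le_rfl, ht⟩, rfl⟩)

/-- The running maximum of the walk. -/
noncomputable def runningMax (z : ℕ ⊕ ℕ → ℝ) (n : ℕ) : ℝ :=
  (Finset.range (n + 1)).sup' Finset.nonempty_range_add_one (walk z)

lemma runningMax_le_iff {z : ℕ ⊕ ℕ → ℝ} {n : ℕ} {u : ℝ} : runningMax z n ≤ u ↔ StaysBelow u z n := by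
  rw [runningMax, Finset.sup'_le_iff]
  simp only [Finset.mem_range, Nat.lt_succ_iff, StaysBelow]

/-- The initial workload enters only through the maximum; the subtracted net time is common to all
`w` and cancels in the externality. -/
lemma workload_arrivalTime (ha : ∀ n, 0 < a n) (hb : ∀ n, 0 ≤ b n) (w : ℝ) (n : ℕ) :
    workload a b w (arrivalTime a n) = max w (runningMax (Sum.elim a b) n)
      - (arrivalTime a n - totalInput a b (arrivalTime a n)) := by
  have h0 := sSup_netTime_nonneg (a := a) (w := w) hb (arrivalTime_pos ha n).le
  rw [workload_eq]
  set M := sSup ((fun s => max (s - totalInput a b s - w) 0) '' Set.Icc 0 (arrivalTime a n)) with hM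
  have : w + M = max w (runningMax (Sum.elim a b) n) := by
    refine eq_of_forall_ge_iff fun c => ?_
    rw [max_le_iff, runningMax_le_iff]
    constructor
    · intro h
      refine ⟨by linarith, ?_⟩
      have := (sSup_netTime_le_iff (w := w) (c := c - w) ha hb (by linarith) n).1
        (by rw [← hM]; linarith)
      simpa using this
    · rintro ⟨h1, h2⟩
      have := (sSup_netTime_le_iff (w := w) (c := c - w) ha hb (by linarith) n).2 (by simpa using h2)
      rw [← hM] at this
      linarith
  linarith

lemma externalityTerm_eq (ha : ∀ n, 0 < a n) (hb : ∀ n, 0 ≤ b n) (v x : ℝ) (n : ℕ) :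
    externalityTerm a b v x n
      = max (v + x) (runningMax (Sum.elim a b) n) - max v (runningMax (Sum.elim a b) n) := by
  rw [externalityTerm, workload_arrivalTime ha hb, workload_arrivalTime ha hb]
  ring

lemma externalityTerm_nonneg (ha : ∀ n, 0 < a n) (hb : ∀ n, 0 ≤ b n) (v : ℝ) {x : ℝ} (hx : 0 ≤ x)
    (n : ℕ) : 0 ≤ externalityTerm a b v x n := by
  rw [externalityTerm_eq ha hb, sub_nonneg]
  exact max_le_max (by linarith) le_rfl

/-- Layer-cake form: `max (v + x) R - max v R` is the length of the part of `(v, v + x]` lying above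
`R`. Whether the endpoint `R` is included is immaterial for Lebesgue measure. -/
lemma ofReal_externalityTerm (ha : ∀ n, 0 < a n) (hb : ∀ n, 0 ≤ b n) (v : ℝ) {x : ℝ} (hx : 0 ≤ x)
    (n : ℕ) : ENNReal.ofReal (externalityTerm a b v x n)
      = ∫⁻ u in Set.Ioc v (v + x), below u (Sum.elim a b) n := by
  classical
  set R := runningMax (Sum.elim a b) n with hR
  have h1 : (fun u => below u (Sum.elim a b) n) = (Set.Ici R).indicator 1 := by
    funext u
    simp [below, Set.indicator, ← runningMax_le_iff, hR]
  have h2 : volume (Set.Ici R ∩ Set.Ioc v (v + x)) = volume (Set.Ioc (max R v) (v + x)) := by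
    have h3 : Set.Ioc (max R v) (v + x) = Set.Ioi R ∩ Set.Ioc v (v + x) := by
      ext u
      simp [and_assoc]
    rw [h3]
    refine measure_congr ?_
    exact (Ioi_ae_eq_Ici (a := R)).symm.inter (ae_eq_refl _)
  rw [externalityTerm_eq ha hb, h1, lintegral_indicator_one measurableSet_Ici,
    Measure.restrict_apply measurableSet_Ici, h2, Real.volume_Ioc]
  rcases le_total (v + x) R with h | h
  · rw [max_eq_right h, max_eq_right (by linarith : v ≤ R), max_eq_left (by linarith : v ≤ R),
      ENNReal.ofReal_of_nonpos (by linarith), ENNReal.ofReal_of_nonpos (by linarith)]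
  · rw [max_eq_left h, max_comm]

/-- An empty system means that net time is at its running maximum, and that maximum is at least the
left limit at the first arrival, which is the first arrival time itself. -/
lemma le_of_workload_eq_zero (ha : ∀ n, 0 < a n) (hb : ∀ n, 0 ≤ b n) {t : ℝ}
    (h0 : arrivalTime a 0 ≤ t) (h : workload a b 0 t = 0) :
    arrivalTime a 0 ≤ t - totalInput a b t := by
  rw [workload_eq] at h
  refine le_of_forall_lt_imp_le_of_dense fun r hr => ?_
  have hlt : max 0 r < arrivalTime a 0 := max_lt (arrivalTime_pos ha 0) hr
  have h1 := le_csSup (bddAbove_netTime (a := a) hb 0 t)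
    ⟨max 0 r, ⟨le_max_left _ _, by linarith⟩, rfl⟩
  have h2 := (le_max_left _ _).trans h1
  have h3 := totalInput_le ha hb hlt
  have h4 := le_max_right 0 r
  simp only [Finset.range_zero, Finset.sum_empty] at h3
  linarith

/-- The number of customers in a busy period is a passage index. -/
lemma firstBusyPeriodCount_eq (ha : ∀ n, 0 < a n) (hb : ∀ n, 0 ≤ b n)
    (hfin : passage (a 0) (Sum.elim a b) ≠ ∞) :
    ∃ n : ℕ, 1 ≤ n ∧ passage (a 0) (Sum.elim a b) = n ∧ firstBusyPeriodCount a b = n := by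
  classical
  have hex := exists_not_staysBelow hfin
  have hn := Nat.find_spec hex
  have hlt : ∀ k < Nat.find hex, StaysBelow (a 0) (Sum.elim a b) k :=
    fun k hk => not_not.1 (Nat.find_min hex hk)
  have hpass := passage_eq_find hex
  set n := Nat.find hex with hndef
  have hT0 : arrivalTime a 0 = a 0 := by simp [arrivalTime]
  have hmono := arrivalTime_strictMono ha
  have hn1 : 1 ≤ n := by
    by_contra! h
    apply hn
    intro k hk
    obtain rfl : k = 0 := by omega
    simp [walk]
  have hwalk : a 0 < walk (Sum.elim a b) n := by
    by_contra! h
    refine hn fun k hk => ?_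
    rcases hk.lt_or_eq with h' | rfl
    · exact hlt k h' k le_rfl
    · exact h
  rw [walk_eq] at hwalk
  have hT : ∀ k < n, arrivalTime a k - ∑ j ∈ Finset.range k, b j ≤ a 0 := fun k hk => by
    simpa [walk_eq] using hlt k hk k le_rfl
  -- The expected end of the busy period: it opens at `a 0` and the server then works off the
  -- services of exactly `n` customers. Customer `n` arrives strictly later, so closed intervals
  -- cause no miscount.
  set t := a 0 + ∑ j ∈ Finset.range n, b j with ht
  have htn : t < arrivalTime a n := by linarith
  have hTt : ∀ j < n, arrivalTime a j ≤ t := fun j hj => by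
    have h1 := hT j hj
    have h2 : ∑ i ∈ Finset.range j, b i ≤ ∑ i ∈ Finset.range n, b i :=
      Finset.sum_le_sum_of_subset_of_nonneg (by simpa using hj.le) fun i _ _ => hb i
    linarith
  have hJt : totalInput a b t = ∑ j ∈ Finset.range n, b j :=
    le_antisymm (totalInput_le ha hb htn) (le_totalInput ha hb htn hTt)
  have hmem : t ∈ {t : ℝ | arrivalTime a 0 ≤ t ∧ workload a b 0 t = 0} := by
    refine ⟨hTt 0 (by omega), ?_⟩
    have hgr : IsGreatest ((fun s => max (s - totalInput a b s - 0) 0) '' Set.Icc 0 t) (a 0) := by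
      constructor
      · refine ⟨t, ⟨?_, le_rfl⟩, ?_⟩
        · linarith [hTt 0 (by omega), ha 0]
        · simp only [hJt]
          rw [max_eq_left] <;> linarith [ha 0]
      · rintro _ ⟨s, hs, rfl⟩
        refine max_le ?_ (ha 0).le
        obtain ⟨k, hk, -, h1, h2⟩ := exists_netTime_le_walk ha hb (hs.2.trans htn.le)
        rcases hk.lt_or_eq with h' | rfl
        · linarith [hT k h']
        · linarith [hs.2]
    rw [workload_eq, hgr.csSup_eq, hJt]
    linarith
  -- The system cannot empty before customer `n - 1` has arrived: up to then the walk stays at or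
  -- below `a 0`, so net time between arrivals stays strictly below `a 0`.
  have hlow : ∀ s ∈ {t : ℝ | arrivalTime a 0 ≤ t ∧ workload a b 0 t = 0}, ∀ k < n,
      arrivalTime a k ≤ s := by
    rintro s ⟨hs0, hs⟩
    by_contra! hc
    have hc' : ∃ k, s < arrivalTime a k := by
      obtain ⟨k, -, hk⟩ := hc
      exact ⟨k, hk⟩
    have h1 := Nat.find_spec hc'
    have h2 : ∀ j < Nat.find hc', arrivalTime a j ≤ s := fun j hj => not_lt.1 (Nat.find_min hc' hj)
    have h3 : Nat.find hc' < n := by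
      obtain ⟨k, hk, hk'⟩ := hc
      exact (Nat.find_min' hc' hk').trans_lt hk
    have h4 := le_totalInput ha hb h1 h2
    have h5 := hT _ h3
    have h6 := le_of_workload_eq_zero ha hb hs0 hs
    linarith
  have hD1 : firstBusyPeriodEnd a b ≤ t := csInf_le ⟨arrivalTime a 0, fun s hs => hs.1⟩ hmem
  have hD2 : ∀ k < n, arrivalTime a k ≤ firstBusyPeriodEnd a b := fun k hk =>
    le_csInf ⟨t, hmem⟩ fun s hs => hlow s hs k hk
  refine ⟨n, hn1, hpass, ?_⟩
  have hset : {m : ℕ | arrivalTime a m ∈ Set.Icc (arrivalTime a 0) (firstBusyPeriodEnd a b)}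
      = (Finset.range n : Set ℕ) := by
    ext m
    simp only [Set.mem_ofPred_eq, Set.mem_Icc, Finset.coe_range, Set.mem_Iio]
    constructor
    · rintro ⟨-, h⟩
      exact hmono.lt_iff_lt.1 (by linarith)
    · exact fun h => ⟨hmono.monotone (Nat.zero_le _), hD2 m h⟩
  rw [firstBusyPeriodCount, hset, Set.encard_coe_eq_coe_finsetCard, Finset.card_range]

end Paths

/-! ### The law of the input -/

lemma measurable_walk (n : ℕ) : Measurable fun z : ℕ ⊕ ℕ → ℝ => walk z n := by
  unfold walk
  fun_prop

lemma measurable_below (n : ℕ) :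
    Measurable fun q : ℝ × (ℕ ⊕ ℕ → ℝ) => below q.1 q.2 n := by
  classical
  refine Measurable.ite ?_ measurable_const measurable_const
  have : {q : ℝ × (ℕ ⊕ ℕ → ℝ) | StaysBelow q.1 q.2 n}
      = ⋂ k ∈ Set.Iic n, {q : ℝ × (ℕ ⊕ ℕ → ℝ) | walk q.2 k ≤ q.1} := by
    ext q
    simp [StaysBelow]
  rw [this]
  exact MeasurableSet.biInter (Set.to_countable _) fun k _ =>
    measurableSet_le ((measurable_walk k).comp measurable_snd) measurable_fst

@[fun_prop]
lemma measurable_passage_prod :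
    Measurable fun q : ℝ × (ℕ ⊕ ℕ → ℝ) => passage q.1 q.2 :=
  Measurable.tsum measurable_below

@[fun_prop]
lemma _root_.Measurable.mg1_passage {α : Type*} [MeasurableSpace α] {f : α → ℝ}
    {g : α → ℕ ⊕ ℕ → ℝ} (hf : Measurable f) (hg : Measurable g) :
    Measurable fun x => passage (f x) (g x) :=
  measurable_passage_prod.comp (hf.prodMk hg)

@[fun_prop]
lemma _root_.Measurable.mg1_below {α : Type*} [MeasurableSpace α] {f : α → ℝ}
    {g : α → ℕ ⊕ ℕ → ℝ} (n : ℕ) (hf : Measurable f) (hg : Measurable g) :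
    Measurable fun x => below (f x) (g x) n :=
  (measurable_below n).comp (hf.prodMk hg)

lemma measurable_consInput : Measurable consInput := by
  refine measurable_pi_lambda _ fun i => ?_
  rcases i with (_ | n) | (_ | n)
  · exact measurable_fst
  · exact (measurable_pi_apply _).comp (measurable_snd.comp measurable_snd)
  · exact measurable_fst.comp measurable_snd
  · exact (measurable_pi_apply _).comp (measurable_snd.comp measurable_snd)

instance isProbabilityMeasure_sumElim {α ν : Measure ℝ} [IsProbabilityMeasure α]
    [IsProbabilityMeasure ν] (i : ℕ ⊕ ℕ) :
    IsProbabilityMeasure (Sum.elim (fun _ => α) (fun _ => ν) i : Measure ℝ) := by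
  cases i <;> simpa

/-- The law of an input with independent interarrival times of law `α` and independent service
requirements of law `ν`. -/
noncomputable def inputLaw (α ν : Measure ℝ) [IsProbabilityMeasure α] [IsProbabilityMeasure ν] :
    Measure (ℕ ⊕ ℕ → ℝ) :=
  Measure.infinitePi (Sum.elim (fun _ => α) (fun _ => ν))

section Law

variable {α ν : Measure ℝ} [IsProbabilityMeasure α] [IsProbabilityMeasure ν]

instance : IsProbabilityMeasure (inputLaw α ν) := by
  unfold inputLaw
  infer_instance

lemma inputLaw_pi (N M : ℕ) {t : ℕ ⊕ ℕ → Set ℝ} (ht : ∀ i, MeasurableSet (t i)) :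
    inputLaw α ν (Set.pi ((Finset.range N).disjSum (Finset.range M) : Finset (ℕ ⊕ ℕ)) t)
      = (∏ i ∈ Finset.range N, α (t (.inl i))) * ∏ i ∈ Finset.range M, ν (t (.inr i)) := by
  rw [inputLaw, Measure.infinitePi_pi _ (fun i _ => ht i), Finset.prod_disjSum]
  rfl

/-- The first customer and the remaining input are independent. -/
lemma map_consInput : (α.prod (ν.prod (inputLaw α ν))).map consInput = inputLaw α ν := by
  classical
  conv_rhs => rw [inputLaw]
  refine Measure.eq_infinitePi _ fun s t ht => ?_
  -- The cylinder is enlarged to a box with equally many interarrival and service coordinates, the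
  -- new factors being `univ`. Removing the first customer then leaves a box of the same shape.
  obtain ⟨N, hN⟩ : ∃ N : ℕ, s ⊆ (Finset.range (N + 1)).disjSum (Finset.range (N + 1)) := by
    refine ⟨s.sup (Sum.elim id id), fun i hi => ?_⟩
    have := Finset.le_sup (f := Sum.elim id id) hi
    rcases i with i | i <;> simpa [Nat.lt_succ_iff] using this
  set t' : ℕ ⊕ ℕ → Set ℝ := fun i => if i ∈ s then t i else Set.univ with ht'
  have hm' : ∀ i, MeasurableSet (t' i) := fun i => by
    by_cases hi : i ∈ s
    · simp [ht', hi, ht]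
    · simp [ht', hi]
  have hpi : (Set.pi s t : Set (ℕ ⊕ ℕ → ℝ))
      = Set.pi ((Finset.range (N + 1)).disjSum (Finset.range (N + 1)) : Finset (ℕ ⊕ ℕ)) t' := by
    ext z
    simp only [Set.mem_pi, Finset.mem_coe, ht']
    constructor
    · intro h i _
      by_cases hi : i ∈ s
      · simpa [hi] using h i hi
      · simp [hi]
    · intro h i hi
      simpa [hi] using h i (hN hi)
  have hprod : ∏ i ∈ s, (Sum.elim (fun _ => α) (fun _ => ν) i : Measure ℝ) (t i)
      = ∏ i ∈ (Finset.range (N + 1)).disjSum (Finset.range (N + 1)),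
        (Sum.elim (fun _ => α) (fun _ => ν) i : Measure ℝ) (t' i) := by
    rw [← Finset.prod_subset hN (fun i _ hi => by simp [ht', hi])]
    exact Finset.prod_congr rfl fun i hi => by simp [ht', hi]
  rw [hpi, hprod, Finset.prod_disjSum, Measure.map_apply measurable_consInput
    (MeasurableSet.pi (Finset.countable_toSet _) fun i _ => hm' i)]
  have hpre : consInput ⁻¹' Set.pi
        ((Finset.range (N + 1)).disjSum (Finset.range (N + 1)) : Finset (ℕ ⊕ ℕ)) t'
      = t' (.inl 0) ×ˢ (t' (.inr 0) ×ˢ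
        Set.pi ((Finset.range N).disjSum (Finset.range N) : Finset (ℕ ⊕ ℕ))
          (fun i => t' (Sum.map Nat.succ Nat.succ i))) := by
    ext p
    simp only [Set.mem_preimage, Set.mem_pi, Set.mem_prod, Finset.mem_coe, Sum.forall,
      Finset.inl_mem_disjSum, Finset.inr_mem_disjSum, Finset.mem_range]
    constructor
    · rintro ⟨h1, h2⟩
      exact ⟨h1 0 (by omega), h2 0 (by omega), fun i hi => h1 (i + 1) (by omega),
        fun i hi => h2 (i + 1) (by omega)⟩
    · rintro ⟨h1, h2, h3, h4⟩
      constructor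
      · rintro (_ | i) hi
        · exact h1
        · exact h3 i (by omega)
      · rintro (_ | i) hi
        · exact h2
        · exact h4 i (by omega)
  rw [hpre, Measure.prod_prod, Measure.prod_prod, inputLaw_pi _ _ fun i => hm' _,
    Finset.prod_range_succ', Finset.prod_range_succ']
  simp only [Sum.elim_inl, Sum.elim_inr, Sum.map_inl, Sum.map_inr, Nat.succ_eq_add_one]
  ring

lemma lintegral_inputLaw {f : (ℕ ⊕ ℕ → ℝ) → ℝ≥0∞} (hf : Measurable f) :
    ∫⁻ z, f z ∂inputLaw α ν
      = ∫⁻ a, ∫⁻ b, ∫⁻ z, f (consInput (a, b, z)) ∂inputLaw α ν ∂ν ∂α := by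
  have hfc : Measurable fun p => f (consInput p) := hf.comp measurable_consInput
  conv_lhs => rw [← map_consInput]
  rw [lintegral_map hf measurable_consInput, lintegral_prod _ hfc.aemeasurable]
  refine lintegral_congr fun a => ?_
  rw [lintegral_prod]
  exact (hfc.comp measurable_prodMk_left).aemeasurable

end Law

/-! ### The exponential distribution -/

section Exponential

variable {r : ℝ}

lemma lintegral_expMeasure {f : ℝ → ℝ≥0∞} (hf : Measurable f) :
    ∫⁻ a, f a ∂expMeasure r = ∫⁻ a, exponentialPDF r a * f a := by
  have hm : Measurable (gammaPDF 1 r) := (measurable_gammaPDFReal 1 r).ennreal_ofReal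
  rw [expMeasure, gammaMeasure, lintegral_withDensity_eq_lintegral_mul _ hm hf]
  rfl

lemma ae_pos_expMeasure : ∀ᵐ a ∂expMeasure r, 0 < a := by
  have h : expMeasure r (Set.Iic 0) = 0 := by
    rw [← lintegral_indicator_one measurableSet_Iic,
      lintegral_expMeasure (measurable_one.indicator measurableSet_Iic),
      lintegral_eq_zero_iff']
    · have h0 : ∀ᵐ a : ℝ, a ≠ 0 := by simp [ae_iff, measure_singleton]
      filter_upwards [h0] with a ha
      rcases ha.lt_or_gt with h | h
      · simp [exponentialPDF_of_neg h]
      · simp [h]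
    · exact ((measurable_exponentialPDFReal r).ennreal_ofReal.mul
        (measurable_one.indicator measurableSet_Iic)).aemeasurable
  rw [ae_iff]
  simpa [Set.Iic] using h

/-- The exponential distribution is memoryless. -/
lemma lintegral_expMeasure_sub {b : ℝ} (hb : 0 ≤ b) {φ : ℝ → ℝ≥0∞} (hφ : Measurable φ) :
    ∫⁻ a, (if b < a then φ (a - b) else 0) ∂expMeasure r
      = ENNReal.ofReal (Real.exp (-(r * b))) * ∫⁻ a, φ a ∂expMeasure r := by
  have hm : Measurable fun a => if b < a then φ (a - b) else 0 :=
    Measurable.ite measurableSet_Ioi (by fun_prop) measurable_const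
  rw [lintegral_expMeasure hm, lintegral_expMeasure hφ, ← lintegral_const_mul' _ _ (by simp),
    ← lintegral_add_right_eq_self _ b]
  -- After the shift by `b` the two integrands can differ at `a = 0`, where the strict inequality
  -- fails but the density is not zero.
  have h0 : ∀ᵐ a : ℝ, a ≠ 0 := by simp [ae_iff, measure_singleton]
  refine lintegral_congr_ae ?_
  filter_upwards [h0] with a ha
  rcases ha.lt_or_gt with h | h
  · simp [exponentialPDF_of_neg h, not_lt.2 h.le]
  · rw [exponentialPDF_of_nonneg h.le, exponentialPDF_of_nonneg (by linarith : 0 ≤ a + b),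
      if_pos (by linarith), ← mul_assoc, ← ENNReal.ofReal_mul (Real.exp_pos _).le,
      add_sub_cancel_right]
    congr 2
    rw [show -(r * (a + b)) = -(r * b) + -(r * a) by ring, Real.exp_add]
    ring

/-- The renewal equation is solved by polynomials. -/
lemma lintegral_expMeasure_poly (hr : 0 < r) {α β u : ℝ} (hα : 0 ≤ α) (hβ : 0 ≤ β) (hu : 0 ≤ u) :
    ∫⁻ a, (if a ≤ u then ENNReal.ofReal
        (α * (u - a) + β * (u - a) ^ 2 + (α + 2 * β * (u - a)) / r) else 0) ∂expMeasure r
      = ENNReal.ofReal (α * u + β * u ^ 2) := by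
  set f : ℝ → ℝ := fun a => r * Real.exp (-(r * a)) *
    (α * (u - a) + β * (u - a) ^ 2 + (α + 2 * β * (u - a)) / r) with hf
  have hcont : Continuous f := by rw [hf]; fun_prop
  -- With `p y = α y + β y ^ 2`, the source term in the statement is `p' / r`; this makes the
  -- integrand the exact derivative of `-exp (-r a) p (u - a)`, and `p 0 = 0` removes the boundary
  -- term at `a = u`.
  have hder : ∀ a ∈ Set.uIcc 0 u, HasDerivAt
      (fun a => -(Real.exp (-(r * a)) * (α * (u - a) + β * (u - a) ^ 2))) (f a) a := by
    intro a _
    have h1 : HasDerivAt (fun a => Real.exp (-(r * a))) (Real.exp (-(r * a)) * (-(r * 1))) a :=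
      ((hasDerivAt_id a).const_mul r).neg.exp
    have h2 : HasDerivAt (fun a : ℝ => u - a) (-1) a := by
      simpa using (hasDerivAt_id a).const_sub u
    have h3 := (h1.mul ((h2.const_mul α).add ((h2.pow 2).const_mul β))).neg
    refine h3.congr_deriv ?_
    simp only [hf, Pi.add_apply, Pi.pow_apply]
    field_simp
    ring
  have hint : ∫ a in (0 : ℝ)..u, f a = α * u + β * u ^ 2 := by
    rw [intervalIntegral.integral_eq_sub_of_hasDerivAt hder (hcont.intervalIntegrable _ _)]
    simp
  have hm : Measurable fun a => if a ≤ u then ENNReal.ofReal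
        (α * (u - a) + β * (u - a) ^ 2 + (α + 2 * β * (u - a)) / r) else 0 :=
    Measurable.ite measurableSet_Iic (by fun_prop) measurable_const
  rw [← hint, intervalIntegral.integral_of_le hu, ← integral_Icc_eq_integral_Ioc,
    ofReal_integral_eq_lintegral_ofReal (hcont.integrableOn_Icc), lintegral_expMeasure hm,
    ← lintegral_indicator measurableSet_Icc]
  · refine lintegral_congr fun a => ?_
    by_cases h0 : 0 ≤ a
    · by_cases h1 : a ≤ u
      · rw [if_pos h1, Set.indicator_of_mem (show a ∈ Set.Icc 0 u from ⟨h0, h1⟩),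
          exponentialPDF_of_nonneg h0, ← ENNReal.ofReal_mul (by positivity)]
      · simp [h1, Set.indicator]
    · simp [exponentialPDF_of_neg (not_le.1 h0), Set.indicator, h0]
  · filter_upwards [ae_restrict_mem measurableSet_Icc] with a ha
    have h1 : 0 ≤ u - a := sub_nonneg.2 ha.2
    simp only [hf, Pi.zero_apply]
    positivity

variable [IsProbabilityMeasure (expMeasure r)]

lemma expMeasure_Ioi {b : ℝ} (hb : 0 ≤ b) :
    expMeasure r (Set.Ioi b) = ENNReal.ofReal (Real.exp (-(r * b))) := by
  have := lintegral_expMeasure_sub (r := r) hb (measurable_const (a := (1 : ℝ≥0∞)))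
  rw [lintegral_const, measure_univ, one_mul, mul_one] at this
  rw [← this, ← lintegral_indicator_one measurableSet_Ioi]
  rfl

lemma expMeasure_Iic_lt_one {b : ℝ} (hb : 0 ≤ b) : expMeasure r (Set.Iic b) < 1 := by
  have h := prob_compl_eq_one_sub (μ := expMeasure r) (measurableSet_Ioi (a := b))
  rw [Set.compl_Ioi, expMeasure_Ioi hb] at h
  rw [h]
  exact ENNReal.sub_lt_self (by simp) (by simp) (by simp [Real.exp_pos])

/-- Comparison principle for the renewal equation. -/
lemma renewal_comparison {f g G : ℝ → ℝ≥0∞} {U : ℝ} {C : ℝ≥0∞} (hC : C ≠ ∞)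
    (hf : ∀ u, 0 ≤ u → u ≤ U →
      f u ≤ ∫⁻ a, (if a ≤ u then G (u - a) + f (u - a) else 0) ∂expMeasure r)
    (hg : ∀ u, 0 ≤ u → u ≤ U →
      ∫⁻ a, (if a ≤ u then G (u - a) + g (u - a) else 0) ∂expMeasure r ≤ g u)
    (hfg : ∀ u, 0 ≤ u → u ≤ U → f u ≤ g u + C) {u : ℝ} (hu : 0 ≤ u) (huU : u ≤ U) :
    f u ≤ g u := by
  set q := expMeasure r (Set.Iic U) with hq
  have hq1 : q < 1 := expMeasure_Iic_lt_one (hu.trans huU)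
  -- Each use of the equation multiplies the possible excess of `f` over `g` by at most `q`, the
  -- probability of an arrival within `U`, and `q < 1`.
  have key : ∀ n : ℕ, ∀ u, 0 ≤ u → u ≤ U → f u ≤ g u + C * q ^ n := by
    intro n
    induction n with
    | zero => simpa using hfg
    | succ n ih =>
      intro u hu huU
      calc f u ≤ ∫⁻ a, (if a ≤ u then G (u - a) + f (u - a) else 0) ∂expMeasure r := hf u hu huU
        _ ≤ ∫⁻ a, ((if a ≤ u then G (u - a) + g (u - a) else 0)
            + (Set.Iic u).indicator (fun _ => C * q ^ n) a) ∂expMeasure r := by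
          refine lintegral_mono_ae ?_
          filter_upwards [ae_pos_expMeasure (r := r)] with a ha
          by_cases h : a ≤ u
          · simp only [h, if_true, Set.indicator, Set.mem_Iic]
            rw [add_assoc]
            gcongr
            exact ih _ (by linarith) (by linarith)
          · simp [h]
        _ = ∫⁻ a, (if a ≤ u then G (u - a) + g (u - a) else 0) ∂expMeasure r
            + C * q ^ n * expMeasure r (Set.Iic u) := by
          rw [lintegral_add_right _ (measurable_const.indicator measurableSet_Iic),
            lintegral_indicator_const measurableSet_Iic]
        _ ≤ g u + C * q ^ (n + 1) := by
          rw [pow_succ, ← mul_assoc]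
          gcongr
          · exact hg u hu huU
          · exact measure_mono (Set.Iic_subset_Iic.2 huU)
  have hlim : Filter.Tendsto (fun n : ℕ => g u + C * q ^ n) Filter.atTop (nhds (g u + C * 0)) := by
    refine Filter.Tendsto.add tendsto_const_nhds (ENNReal.Tendsto.const_mul
      (ENNReal.tendsto_pow_atTop_nhds_zero_of_lt_one hq1) (.inr hC))
  simpa using ge_of_tendsto' hlim fun n => key n u hu huU

end Exponential

/-! ### Independent increments of the passage index -/

section Increments

variable {r : ℝ} {ν : Measure ℝ} [IsProbabilityMeasure (expMeasure r)] [IsProbabilityMeasure ν]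

omit [IsProbabilityMeasure ν] in
lemma ae_nonneg_of_Iio (hν : ν (Set.Iio 0) = 0) : ∀ᵐ b ∂ν, 0 ≤ b := by
  rw [ae_iff]
  simpa [Set.Iio] using hν

lemma lintegral_ite_const {α : Type*} [MeasurableSpace α] {μ : Measure α} (p : Prop) [Decidable p]
    (f : α → ℝ≥0∞) : ∫⁻ x, (if p then f x else 0) ∂μ = if p then ∫⁻ x, f x ∂μ else 0 := by
  split_ifs <;> simp

/-- Given its value at one level, the passage index starts afresh from this level. -/
lemma lintegral_passage_fiber (hν : ν (Set.Iio 0) = 0) (n : ℕ) {H : ℝ≥0∞ → ℝ≥0∞}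
    (hH : Measurable H) {c w : ℝ} (hc : 0 ≤ c) (hw : 0 ≤ w) :
    ∫⁻ z, (if passage c z = n then H (passage (c + w) z) else 0) ∂inputLaw (expMeasure r) ν
      = (∫⁻ z, (if passage c z = n then 1 else 0) ∂inputLaw (expMeasure r) ν)
        * ∫⁻ z, H (n + passage w z) ∂inputLaw (expMeasure r) ν := by
  have hset : ∀ (m : ℕ) (d : ℝ), MeasurableSet {z : ℕ ⊕ ℕ → ℝ | passage d z = m} := fun m d =>
    measurableSet_eq_fun (by fun_prop) measurable_const
  have hm1 : ∀ {H : ℝ≥0∞ → ℝ≥0∞}, Measurable H → ∀ (m : ℕ) (d e : ℝ),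
      Measurable fun z : ℕ ⊕ ℕ → ℝ => if passage d z = m then H (passage e z) else 0 :=
    fun hH m d e => Measurable.ite (hset m d) (hH.comp (by fun_prop)) measurable_const
  have hm2 : ∀ (m : ℕ) (d : ℝ),
      Measurable fun z : ℕ ⊕ ℕ → ℝ => if passage d z = m then (1 : ℝ≥0∞) else 0 :=
    fun m d => Measurable.ite (hset m d) measurable_const measurable_const
  -- Both `H` and `c` must vary: passing the first customer replaces `c` by `c - a + b` and adds one
  -- to the argument of `H`.
  induction n generalizing H c with
  | zero =>
    have hΦ : Measurable fun a => ∫⁻ b, ∫⁻ z, H (passage w (consInput (a, b, z)))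
        ∂inputLaw (expMeasure r) ν ∂ν := by
      refine Measurable.lintegral_prod_right' (f := fun q : ℝ × ℝ => ∫⁻ z, H (passage w
        (consInput (q.1, q.2, z))) ∂inputLaw (expMeasure r) ν) ?_
      refine Measurable.lintegral_prod_right' (f := fun q : (ℝ × ℝ) × (ℕ ⊕ ℕ → ℝ) =>
        H (passage w (consInput (q.1.1, q.1.2, q.2)))) ?_
      exact hH.comp (measurable_const.mg1_passage (measurable_consInput.comp (by fun_prop)))
    -- Passage index zero means that the first interarrival time exceeds `c`. The excess `a - c` is
    -- again exponential, so it can serve as the first interarrival time of a fresh input seen from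
    -- level `c`.
    have h1 : ∀ a b : ℝ, ∀ z, (if passage c (consInput (a, b, z)) = (0 : ℕ)
        then H (passage (c + w) (consInput (a, b, z))) else 0)
        = if c < a then H (passage w (consInput (a - c, b, z))) else 0 := by
      intro a b z
      simp only [passage_consInput]
      rcases lt_or_ge c a with h | h
      · have e1 : c + w - a + b = w - (a - c) + b := by ring
        have e2 : (a ≤ c + w) = (a - c ≤ w) := by
          rw [sub_le_iff_le_add, add_comm w]
        simp [not_le.2 h, h, e1, e2]
      · simp [h, not_lt.2 h]
    have h2 : ∀ a b : ℝ, ∀ z, (if passage c (consInput (a, b, z)) = (0 : ℕ) then (1 : ℝ≥0∞) else 0)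
        = if c < a then 1 else 0 := by
      intro a b z
      simp only [passage_consInput]
      rcases lt_or_ge c a with h | h
      · simp [not_le.2 h, h]
      · simp [h, not_lt.2 h]
    rw [lintegral_inputLaw (hm1 hH _ _ _), lintegral_inputLaw (hm2 _ _)]
    simp only [h1, h2, lintegral_ite_const]
    have h3 := lintegral_expMeasure_sub (r := r) hc (measurable_const (a := (1 : ℝ≥0∞)))
    simp only [lintegral_const, measure_univ, mul_one] at h3
    rw [lintegral_expMeasure_sub hc hΦ]
    simp only [lintegral_const, measure_univ, mul_one, Nat.cast_zero, zero_add]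
    rw [h3, lintegral_inputLaw (f := fun z => H (passage w z)) (hH.comp (by fun_prop))]
  | succ n ih =>
    have hcast : ∀ x : ℝ≥0∞, 1 + x = (n + 1 : ℕ) ↔ x = n := by
      intro x
      rw [Nat.cast_add, Nat.cast_one, add_comm]
      exact ENNReal.add_left_inj (by simp)
    have h1 : ∀ (H : ℝ≥0∞ → ℝ≥0∞) (a b : ℝ) (z), (if passage c (consInput (a, b, z)) = (n + 1 : ℕ)
        then H (passage (c + w) (consInput (a, b, z))) else 0)
        = if a ≤ c then (if passage (c - a + b) z = n
          then H (1 + passage (c - a + b + w) z) else 0) else 0 := by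
      intro H a b z
      simp only [passage_consInput]
      by_cases h : a ≤ c
      · have e1 : c + w - a + b = c - a + b + w := by ring
        simp only [h, if_true, e1, hcast, show a ≤ c + w by linarith]
      · have : ¬ (0 : ℝ≥0∞) = (n + 1 : ℕ) := by exact_mod_cast (Nat.succ_ne_zero n).symm
        simp only [h, if_false, this]
    rw [lintegral_inputLaw (hm1 hH _ _ _), lintegral_inputLaw (hm2 _ _)]
    have h2 := h1 fun _ => 1
    simp only [h1, h2, lintegral_ite_const]
    have hm3 : ∀ a, Measurable fun b => ∫⁻ z, (if passage (c - a + b) z = n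
        then (1 : ℝ≥0∞) else 0) ∂inputLaw (expMeasure r) ν := fun a => by
      refine Measurable.lintegral_prod_right' (f := fun q : ℝ × (ℕ ⊕ ℕ → ℝ) =>
        if passage (c - a + q.1) q.2 = n then (1 : ℝ≥0∞) else 0) ?_
      exact Measurable.ite (measurableSet_eq_fun (by fun_prop) measurable_const)
        measurable_const measurable_const
    have hm4 : Measurable fun a => if a ≤ c then ∫⁻ b, ∫⁻ z, (if passage (c - a + b) z = n
        then (1 : ℝ≥0∞) else 0) ∂inputLaw (expMeasure r) ν ∂ν else 0 := by
      refine Measurable.ite measurableSet_Iic ?_ measurable_const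
      refine Measurable.lintegral_prod_right' (f := fun q : ℝ × ℝ => ∫⁻ z,
        (if passage (c - q.1 + q.2) z = n then (1 : ℝ≥0∞) else 0) ∂inputLaw (expMeasure r) ν) ?_
      refine Measurable.lintegral_prod_right' (f := fun q : (ℝ × ℝ) × (ℕ ⊕ ℕ → ℝ) =>
        if passage (c - q.1.1 + q.1.2) q.2 = n then (1 : ℝ≥0∞) else 0) ?_
      exact Measurable.ite (measurableSet_eq_fun (by fun_prop) measurable_const)
        measurable_const measurable_const
    rw [← lintegral_mul_const _ hm4]
    refine lintegral_congr fun a => ?_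
    by_cases h : a ≤ c
    · simp only [h, if_true]
      rw [← lintegral_mul_const _ (hm3 a)]
      refine lintegral_congr_ae ?_
      filter_upwards [ae_nonneg_of_Iio hν] with b hb
      rw [ih (H := fun x => H (1 + x)) (by fun_prop) (by linarith : 0 ≤ c - a + b)]
      congr 1
      refine lintegral_congr fun z => ?_
      rw [← add_assoc, add_comm 1 (n : ℝ≥0∞)]
      push_cast
      rfl
    · simp only [h, if_false, zero_mul]

/-- The increments of the passage index are independent and stationary. -/
lemma lintegral_passage_add (hν : ν (Set.Iio 0) = 0) {c w : ℝ} (hc : 0 ≤ c) (hw : 0 ≤ w)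
    (hfin : ∀ᵐ z ∂inputLaw (expMeasure r) ν, passage c z ≠ ∞)
    {G : ℝ≥0∞ → ℝ≥0∞ → ℝ≥0∞} (hG : ∀ x, Measurable (G x)) :
    ∫⁻ z, G (passage c z) (passage (c + w) z) ∂inputLaw (expMeasure r) ν
      = ∫⁻ z, ∫⁻ z', G (passage c z) (passage c z + passage w z')
          ∂inputLaw (expMeasure r) ν ∂inputLaw (expMeasure r) ν := by
  have hset : ∀ m : ℕ, MeasurableSet {z : ℕ ⊕ ℕ → ℝ | passage c z = m} := fun m =>
    measurableSet_eq_fun (by fun_prop) measurable_const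
  -- The passage index is almost surely a natural number, so integrals split over its values and the
  -- fiberwise identity applies to each.
  have key : ∀ (F : ℝ≥0∞ → (ℕ ⊕ ℕ → ℝ) → ℝ≥0∞), (∀ n : ℕ, Measurable (F n)) →
      ∫⁻ z, F (passage c z) z ∂inputLaw (expMeasure r) ν
        = ∑' n : ℕ, ∫⁻ z, (if passage c z = n then F n z else 0) ∂inputLaw (expMeasure r) ν := by
    intro F hF
    rw [← lintegral_tsum fun n => (Measurable.ite (hset n) (hF n) measurable_const).aemeasurable]
    refine lintegral_congr_ae ?_
    filter_upwards [hfin] with z hz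
    obtain ⟨n, hn⟩ := (passage_eq_natCast_or_top c z).resolve_left hz
    rw [tsum_eq_single n]
    · simp [hn]
    · intro m hm
      rw [if_neg]
      rw [hn]
      exact_mod_cast hm.symm
  rw [key (fun x z => G x (passage (c + w) z)) fun n => (hG n).comp (by fun_prop),
    key (fun x _ => ∫⁻ z', G x (x + passage w z') ∂inputLaw (expMeasure r) ν)
      fun n => measurable_const]
  congr 1
  funext n
  rw [lintegral_passage_fiber hν n (hG n) hc hw,
    ← lintegral_mul_const _ (Measurable.ite (hset n) measurable_const measurable_const)]
  refine lintegral_congr fun z => ?_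
  split_ifs <;> simp

end Increments

/-! ### The moments of the passage index -/

section Moments

/-- The `k`-th moment of the passage index. -/
noncomputable def passageMoment (r : ℝ) (ν : Measure ℝ) [IsProbabilityMeasure (expMeasure r)]
    [IsProbabilityMeasure ν] (k : ℕ) (u : ℝ) : ℝ≥0∞ :=
  ∫⁻ z, passage u z ^ k ∂inputLaw (expMeasure r) ν

/-- The `k`-th moment of the number of customers in a busy period. -/
noncomputable def busyMoment (r : ℝ) (ν : Measure ℝ) [IsProbabilityMeasure (expMeasure r)]
    [IsProbabilityMeasure ν] (k : ℕ) : ℝ≥0∞ :=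
  ∫⁻ b, ∫⁻ z, (1 + passage b z) ^ k ∂inputLaw (expMeasure r) ν ∂ν

variable {r : ℝ} {ν : Measure ℝ} [IsProbabilityMeasure (expMeasure r)] [IsProbabilityMeasure ν]

lemma lintegral_comp_passage {F : ℝ≥0∞ → ℝ≥0∞} (hF : Measurable F) (hF0 : F 0 = 0) (u : ℝ) :
    ∫⁻ z, F (passage u z) ∂inputLaw (expMeasure r) ν
      = ∫⁻ a, (if a ≤ u then ∫⁻ b, ∫⁻ z, F (1 + passage (u - a + b) z)
          ∂inputLaw (expMeasure r) ν ∂ν else 0) ∂expMeasure r := by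
  rw [lintegral_inputLaw (f := fun z => F (passage u z)) (hF.comp (by fun_prop))]
  simp only [passage_consInput, apply_ite F, hF0, lintegral_ite_const]

/-- Truncation makes the recursion step from `N` to `N + 1`, so bounds can be proved by induction
before any moment is known to be finite. -/
lemma lintegral_comp_sum_below (N : ℕ) {F : ℝ≥0∞ → ℝ≥0∞} (hF : Measurable F) (hF0 : F 0 = 0)
    (u : ℝ) :
    ∫⁻ z, F (∑ n ∈ Finset.range (N + 1), below u z n) ∂inputLaw (expMeasure r) ν
      = ∫⁻ a, (if a ≤ u then ∫⁻ b, ∫⁻ z, F (1 + ∑ n ∈ Finset.range N, below (u - a + b) z n)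
          ∂inputLaw (expMeasure r) ν ∂ν else 0) ∂expMeasure r := by
  rw [lintegral_inputLaw (f := fun z => F (∑ n ∈ Finset.range (N + 1), below u z n))
    (hF.comp (by fun_prop))]
  simp only [sum_below_consInput, apply_ite F, hF0, lintegral_ite_const]

omit [IsProbabilityMeasure (expMeasure r)] in
/-- The integral of a quadratic polynomial over the service distribution. -/
lemma lintegral_service_poly (hν : ν (Set.Iio 0) = 0) {p q s : ℝ} (hp : 0 ≤ p) (hq : 0 ≤ q)
    (hs : 0 ≤ s) :
    ∫⁻ b, ENNReal.ofReal (p + q * b + s * b ^ 2) ∂ν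
      = ENNReal.ofReal p + ENNReal.ofReal q * serviceMoment ν 1
        + ENNReal.ofReal s * serviceMoment ν 2 := by
  have h : ∀ᵐ b ∂ν, ENNReal.ofReal (p + q * b + s * b ^ 2)
      = ENNReal.ofReal p + ENNReal.ofReal q * ENNReal.ofReal b ^ 1
        + ENNReal.ofReal s * ENNReal.ofReal b ^ 2 := by
    filter_upwards [ae_nonneg_of_Iio hν] with b hb
    rw [pow_one, ← ENNReal.ofReal_pow hb, ← ENNReal.ofReal_mul hq, ← ENNReal.ofReal_mul hs,
      ← ENNReal.ofReal_add hp (by positivity), ← ENNReal.ofReal_add (by positivity) (by positivity)]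
  rw [lintegral_congr_ae h, lintegral_add_left (by fun_prop), lintegral_add_left (by fun_prop),
    lintegral_const_mul _ (by fun_prop), lintegral_const_mul _ (by fun_prop)]
  simp [serviceMoment]

/-- If the truncated moments of order `k` are bounded, so is the moment. -/
lemma passageMoment_le (k : ℕ) {u : ℝ} {C : ℝ≥0∞}
    (h : ∀ N, ∫⁻ z, (∑ n ∈ Finset.range N, below u z n) ^ k ∂inputLaw (expMeasure r) ν ≤ C) :
    passageMoment r ν k u ≤ C := by
  refine le_of_tendsto' (lintegral_tendsto_of_tendsto_of_monotone (fun N => ?_) ?_ ?_) h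
  · exact Measurable.aemeasurable (by fun_prop)
  · refine ae_of_all _ fun z N M hNM => ?_
    exact pow_le_pow_left' (Finset.sum_le_sum_of_subset (by simpa using hNM)) k
  · refine ae_of_all _ fun z => ?_
    exact ENNReal.Tendsto.pow (ENNReal.tendsto_nat_tsum _)

/-- The slope of the mean passage index. -/
noncomputable def passageRate (r : ℝ) (ν : Measure ℝ) : ℝ := r / (1 - r * (serviceMoment ν 1).toReal)

section Load

omit [IsProbabilityMeasure (expMeasure r)] [IsProbabilityMeasure ν]

lemma serviceMoment_one_ne_top (hr : 0 < r) (hρ : ENNReal.ofReal r * serviceMoment ν 1 < 1) :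
    serviceMoment ν 1 ≠ ∞ := by
  intro h
  rw [h, ENNReal.mul_top (by simpa using hr)] at hρ
  simp at hρ

lemma load_pos (hr : 0 < r) (hρ : ENNReal.ofReal r * serviceMoment ν 1 < 1) :
    0 < 1 - r * (serviceMoment ν 1).toReal := by
  have h := ENNReal.toReal_strict_mono ENNReal.one_ne_top hρ
  rw [ENNReal.toReal_mul, ENNReal.toReal_ofReal hr.le, ENNReal.toReal_one] at h
  linarith

lemma passageRate_pos (hr : 0 < r) (hρ : ENNReal.ofReal r * serviceMoment ν 1 < 1) :
    0 < passageRate r ν := div_pos hr (load_pos hr hρ)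

/-- The balance that makes `c u` reproduce itself under the first-customer recursion: each customer
contributes one plus the mean `c μ₁` generated by the service, which must equal the source `c / r`.
-/
lemma passageRate_eq (hr : 0 < r) (hρ : ENNReal.ofReal r * serviceMoment ν 1 < 1) :
    1 + passageRate r ν * (serviceMoment ν 1).toReal = passageRate r ν / r := by
  have := load_pos hr hρ
  rw [passageRate]
  field_simp
  ring

end Load

variable (hr : 0 < r) (hν : ν (Set.Iio 0) = 0) (hρ : ENNReal.ofReal r * serviceMoment ν 1 < 1)

include hr hν hρ

/-- The linear function is a fixed point of the recursion satisfied by the truncated means, which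
start from zero; monotonicity keeps them below it. -/
lemma lintegral_sum_below_le (N : ℕ) {u : ℝ} (hu : 0 ≤ u) :
    ∫⁻ z, (∑ n ∈ Finset.range N, below u z n) ∂inputLaw (expMeasure r) ν
      ≤ ENNReal.ofReal (passageRate r ν * u) := by
  have hc := passageRate_pos hr hρ
  have hμ := serviceMoment_one_ne_top hr hρ
  induction N generalizing u with
  | zero => simp
  | succ N ih =>
    rw [lintegral_comp_sum_below N (F := fun x => x) measurable_id rfl,
      ← add_zero (passageRate r ν * u), ← zero_mul (u ^ 2),
      ← lintegral_expMeasure_poly hr hc.le le_rfl hu]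
    refine lintegral_mono fun a => ?_
    by_cases h : a ≤ u
    · simp only [h, if_true]
      have hua : 0 ≤ u - a := sub_nonneg.2 h
      calc ∫⁻ b, ∫⁻ z, (1 + ∑ n ∈ Finset.range N, below (u - a + b) z n)
              ∂inputLaw (expMeasure r) ν ∂ν
          ≤ ∫⁻ b, ENNReal.ofReal
              (1 + passageRate r ν * (u - a) + passageRate r ν * b + 0 * b ^ 2) ∂ν := by
            refine lintegral_mono_ae ?_
            filter_upwards [ae_nonneg_of_Iio hν] with b hb
            rw [lintegral_add_left measurable_const, lintegral_const, measure_univ, mul_one]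
            calc _ ≤ 1 + ENNReal.ofReal (passageRate r ν * (u - a + b)) := by
                  gcongr
                  exact ih (by positivity)
              _ = _ := by
                  rw [← ENNReal.ofReal_one, ← ENNReal.ofReal_add (by simp) (by positivity)]
                  ring_nf
        _ = ENNReal.ofReal (1 + passageRate r ν * (u - a)
              + passageRate r ν * (serviceMoment ν 1).toReal) := by
            rw [lintegral_service_poly hν (by positivity) hc.le le_rfl, ENNReal.ofReal_zero, zero_mul,
              add_zero]
            conv_rhs => rw [ENNReal.ofReal_add (by positivity) (by positivity),
              ENNReal.ofReal_mul hc.le, ENNReal.ofReal_toReal hμ]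
        _ ≤ _ := by
            refine ENNReal.ofReal_le_ofReal (le_of_eq ?_)
            linear_combination passageRate_eq hr hρ
    · simp [h]

lemma passageMoment_one_le {u : ℝ} (hu : 0 ≤ u) :
    passageMoment r ν 1 u ≤ ENNReal.ofReal (passageRate r ν * u) :=
  passageMoment_le 1 fun N => by simpa using lintegral_sum_below_le hr hν hρ N hu

lemma passage_ae_ne_top {u : ℝ} (hu : 0 ≤ u) :
    ∀ᵐ z ∂inputLaw (expMeasure r) ν, passage u z ≠ ∞ := by
  have h := (passageMoment_one_le hr hν hρ hu).trans_lt ENNReal.ofReal_lt_top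
  simp only [passageMoment, pow_one] at h
  filter_upwards [ae_lt_top (by fun_prop) h.ne] with z hz using hz.ne

/-- The same fixed-point argument with a quadratic. The `u ^ 2` coefficient is the squared mean
slope; the linear coefficient `α` must not depend on `N`. -/
lemma lintegral_sum_below_sq_le (h2 : serviceMoment ν 2 ≠ ∞) :
    ∃ α : ℝ, 0 ≤ α ∧ ∀ (N : ℕ) (u : ℝ), 0 ≤ u →
      ∫⁻ z, (∑ n ∈ Finset.range N, below u z n) ^ 2 ∂inputLaw (expMeasure r) ν
        ≤ ENNReal.ofReal (α * u + passageRate r ν ^ 2 * u ^ 2) := by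
  have hc := passageRate_pos hr hρ
  have hμ := serviceMoment_one_ne_top hr hρ
  have hρ' := load_pos hr hρ
  have hceq := passageRate_eq hr hρ
  have hbound := fun N u => lintegral_sum_below_le (N := N) (u := u) hr hν hρ
  set c := passageRate r ν
  set m := (serviceMoment ν 1).toReal
  set m2 := (serviceMoment ν 2).toReal
  have hm : 0 ≤ m := ENNReal.toReal_nonneg
  have hm2 : 0 ≤ m2 := ENNReal.toReal_nonneg
  -- Solves the balance of constant terms `1 + 2cm + αm + c²m₂ = α / r`; load below one makes the
  -- denominator positive.
  set α := r * (1 + 2 * c * m + c ^ 2 * m2) / (1 - r * m) with hα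
  have hαeq : 1 + 2 * c * m + α * m + c ^ 2 * m2 = α / r := by
    have h1 : α * (1 - r * m) = r * (1 + 2 * c * m + c ^ 2 * m2) := by
      rw [hα, div_mul_cancel₀ _ hρ'.ne']
    field_simp
    linarith
  have hα0 : 0 ≤ α := by positivity
  refine ⟨α, hα0, fun N => ?_⟩
  induction N with
  | zero => simp
  | succ N ih =>
    intro u hu
    rw [lintegral_comp_sum_below N (F := fun x => x ^ 2) (by fun_prop) (by simp),
      ← lintegral_expMeasure_poly hr hα0 (sq_nonneg c) hu]
    refine lintegral_mono fun a => ?_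
    by_cases h : a ≤ u
    · simp only [h, if_true]
      obtain ⟨y, hy⟩ : ∃ y, y = u - a := ⟨_, rfl⟩
      have hy0 : 0 ≤ y := by rw [hy]; exact sub_nonneg.2 h
      rw [← hy]
      calc ∫⁻ b, ∫⁻ z, (1 + ∑ n ∈ Finset.range N, below (y + b) z n) ^ 2
              ∂inputLaw (expMeasure r) ν ∂ν
          ≤ ∫⁻ b, ENNReal.ofReal ((1 + (2 * c + α) * y + c ^ 2 * y ^ 2)
              + (2 * c + α + 2 * c ^ 2 * y) * b + c ^ 2 * b ^ 2) ∂ν := by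
            refine lintegral_mono_ae ?_
            filter_upwards [ae_nonneg_of_Iio hν] with b hb
            have hx : 0 ≤ y + b := by positivity
            have hexp : ∀ z, (1 + ∑ n ∈ Finset.range N, below (y + b) z n) ^ 2
                = 1 + (2 * (∑ n ∈ Finset.range N, below (y + b) z n)
                  + (∑ n ∈ Finset.range N, below (y + b) z n) ^ 2) := fun z => by ring
            simp only [hexp]
            rw [lintegral_add_left measurable_const, lintegral_const, measure_univ, mul_one,
              lintegral_add_left (by fun_prop), lintegral_const_mul _ (by fun_prop)]
            calc _ ≤ 1 + (2 * ENNReal.ofReal (c * (y + b))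
                    + ENNReal.ofReal (α * (y + b) + c ^ 2 * (y + b) ^ 2)) := by
                  gcongr
                  · exact hbound N _ hx
                  · exact ih _ hx
              _ = _ := by
                  rw [← ENNReal.ofReal_ofNat 2, ← ENNReal.ofReal_mul (by simp), ← ENNReal.ofReal_one,
                    ← ENNReal.ofReal_add (by positivity) (by positivity),
                    ← ENNReal.ofReal_add (by simp) (by positivity)]
                  ring_nf
        _ = ENNReal.ofReal ((1 + (2 * c + α) * y + c ^ 2 * y ^ 2)
              + (2 * c + α + 2 * c ^ 2 * y) * m + c ^ 2 * m2) := by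
            rw [lintegral_service_poly hν (by positivity) (by positivity) (by positivity)]
            conv_rhs => rw [ENNReal.ofReal_add (by positivity) (by positivity),
              ENNReal.ofReal_add (by positivity) (by positivity),
              ENNReal.ofReal_mul (by positivity), ENNReal.ofReal_mul (by positivity),
              ENNReal.ofReal_toReal hμ, ENNReal.ofReal_toReal h2]
        _ ≤ _ := by
            refine ENNReal.ofReal_le_ofReal (le_of_eq ?_)
            -- The constant terms balance by the choice of `α`, the terms linear in `y` by the
            -- equation for `c`.
            linear_combination hαeq + 2 * c * y * hceq
    · simp [h]

lemma exists_passageMoment_two_le (h2 : serviceMoment ν 2 ≠ ∞) :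
    ∃ α : ℝ, 0 ≤ α ∧ ∀ u : ℝ, 0 ≤ u →
      passageMoment r ν 2 u ≤ ENNReal.ofReal (α * u + passageRate r ν ^ 2 * u ^ 2) := by
  obtain ⟨α, hα, h⟩ := lintegral_sum_below_sq_le hr hν hρ h2
  exact ⟨α, hα, fun u hu => passageMoment_le 2 fun N => h N u hu⟩

end Moments

/-! ### Exact first and second moments of the passage index via renewal equations -/

section ExactMoments

variable {r : ℝ} {ν : Measure ℝ} [IsProbabilityMeasure (expMeasure r)] [IsProbabilityMeasure ν]

lemma one_le_busyMoment (k : ℕ) : 1 ≤ busyMoment r ν k := by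
  calc (1 : ℝ≥0∞) = ∫⁻ _ : ℝ, ∫⁻ _ : ℕ ⊕ ℕ → ℝ, 1 ∂inputLaw (expMeasure r) ν ∂ν := by simp
    _ ≤ _ := by
      unfold busyMoment
      gcongr with b z
      exact one_le_pow_of_one_le' (by simp) k

lemma measurable_lintegral_busy (k : ℕ) :
    Measurable fun b => ∫⁻ z, (1 + passage b z) ^ k ∂inputLaw (expMeasure r) ν :=
  Measurable.lintegral_prod_right' (f := fun q : ℝ × (ℕ ⊕ ℕ → ℝ) => (1 + passage q.1 q.2) ^ k)
    (by fun_prop)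

variable (hr : 0 < r) (hν : ν (Set.Iio 0) = 0) (hρ : ENNReal.ofReal r * serviceMoment ν 1 < 1)

include hr hν hρ

lemma busyMoment_one_ne_top : busyMoment r ν 1 ≠ ∞ := by
  have hc := passageRate_pos hr hρ
  refine ne_top_of_le_ne_top (b := ENNReal.ofReal 1
    + ENNReal.ofReal (passageRate r ν) * serviceMoment ν 1
    + ENNReal.ofReal 0 * serviceMoment ν 2) ?_ ?_
  · simp [ENNReal.mul_eq_top, serviceMoment_one_ne_top hr hρ]
  · rw [← lintegral_service_poly hν zero_le_one hc.le le_rfl, busyMoment]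
    refine lintegral_mono_ae ?_
    filter_upwards [ae_nonneg_of_Iio hν] with b hb
    simp only [pow_one, zero_mul, add_zero]
    rw [lintegral_add_left measurable_const, lintegral_const, measure_univ, mul_one,
      ENNReal.ofReal_add zero_le_one (by positivity), ENNReal.ofReal_one]
    gcongr
    simpa [passageMoment] using passageMoment_one_le hr hν hρ hb

/-- The busy period moment generated by a level `c + w`. -/
lemma lintegral_one_add_passage_add {c w : ℝ} (hc : 0 ≤ c) (hw : 0 ≤ w) :
    ∫⁻ z, (1 + passage (c + w) z) ∂inputLaw (expMeasure r) ν
      = ∫⁻ z, (1 + passage c z) ^ 1 ∂inputLaw (expMeasure r) ν + passageMoment r ν 1 w := by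
  rw [lintegral_passage_add hν hc hw (passage_ae_ne_top hr hν hρ hc) (G := fun _ y => 1 + y)
    (fun _ => by fun_prop)]
  simp only [← add_assoc, pow_one]
  rw [lintegral_congr fun z => lintegral_add_left measurable_const _]
  simp only [lintegral_const, measure_univ, mul_one]
  rw [lintegral_add_right _ measurable_const, lintegral_const, measure_univ, mul_one]
  simp [passageMoment]

lemma lintegral_one_add_passage_add_sq {c w : ℝ} (hc : 0 ≤ c) (hw : 0 ≤ w) :
    ∫⁻ z, (1 + passage (c + w) z) ^ 2 ∂inputLaw (expMeasure r) ν
      = ∫⁻ z, (1 + passage c z) ^ 2 ∂inputLaw (expMeasure r) ν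
        + (∫⁻ z, (1 + passage c z) ^ 1 ∂inputLaw (expMeasure r) ν) * (2 * passageMoment r ν 1 w)
        + passageMoment r ν 2 w := by
  rw [lintegral_passage_add hν hc hw (passage_ae_ne_top hr hν hρ hc) (G := fun _ y => (1 + y) ^ 2)
    (fun _ => by fun_prop)]
  have h : ∀ z, ∫⁻ z', (1 + (passage c z + passage w z')) ^ 2 ∂inputLaw (expMeasure r) ν
      = (1 + passage c z) ^ 2 + (1 + passage c z) ^ 1 * (2 * passageMoment r ν 1 w)
        + passageMoment r ν 2 w := by
    intro z
    have hexp : ∀ z', (1 + (passage c z + passage w z')) ^ 2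
        = (1 + passage c z) ^ 2 + (1 + passage c z) ^ 1 * 2 * passage w z' ^ 1
          + passage w z' ^ 2 := fun z' => by ring
    simp only [hexp]
    rw [lintegral_add_left (by fun_prop), lintegral_add_left (by fun_prop),
      lintegral_const_mul _ (by fun_prop), lintegral_const, measure_univ, mul_one, mul_assoc]
    rfl
  simp only [h]
  rw [lintegral_add_left (by fun_prop), lintegral_add_left (by fun_prop),
    lintegral_mul_const _ (by fun_prop), lintegral_const, measure_univ, mul_one]

/-- After the first customer the level is `b + (u - a)`. The part up to `b`, together with that
customer, has the law of a busy period count; the increment over `u - a` is independent of it. -/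
lemma passageMoment_one_renewal (u : ℝ) :
    passageMoment r ν 1 u
      = ∫⁻ a, (if a ≤ u then busyMoment r ν 1 + passageMoment r ν 1 (u - a) else 0)
        ∂expMeasure r := by
  rw [passageMoment, lintegral_comp_passage (F := fun x => x ^ 1) (by fun_prop) (by simp)]
  refine lintegral_congr fun a => ?_
  by_cases h : a ≤ u
  · simp only [h, if_true]
    rw [lintegral_congr_ae (g := fun b => ∫⁻ z, (1 + passage b z) ^ 1 ∂inputLaw (expMeasure r) ν
      + passageMoment r ν 1 (u - a)), lintegral_add_right _ measurable_const, lintegral_const,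
      measure_univ, mul_one, busyMoment]
    filter_upwards [ae_nonneg_of_Iio hν] with b hb
    rw [← lintegral_one_add_passage_add hr hν hρ hb (sub_nonneg.2 h), add_comm b]
    simp only [pow_one]
  · simp [h]

lemma passageMoment_two_renewal (u : ℝ) :
    passageMoment r ν 2 u
      = ∫⁻ a, (if a ≤ u then (busyMoment r ν 2
          + busyMoment r ν 1 * (2 * passageMoment r ν 1 (u - a)))
          + passageMoment r ν 2 (u - a) else 0) ∂expMeasure r := by
  rw [passageMoment, lintegral_comp_passage (F := fun x => x ^ 2) (by fun_prop) (by simp)]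
  refine lintegral_congr fun a => ?_
  by_cases h : a ≤ u
  · simp only [h, if_true]
    rw [lintegral_congr_ae (g := fun b => ∫⁻ z, (1 + passage b z) ^ 2 ∂inputLaw (expMeasure r) ν
      + (∫⁻ z, (1 + passage b z) ^ 1 ∂inputLaw (expMeasure r) ν)
        * (2 * passageMoment r ν 1 (u - a))
      + passageMoment r ν 2 (u - a)), lintegral_add_right _ measurable_const, lintegral_const,
      measure_univ, mul_one, lintegral_add_left (measurable_lintegral_busy 2),
      lintegral_mul_const _ (measurable_lintegral_busy 1), busyMoment, busyMoment]
    filter_upwards [ae_nonneg_of_Iio hν] with b hb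
    rw [← lintegral_one_add_passage_add_sq hr hν hρ hb (sub_nonneg.2 h), add_comm b]
  · simp [h]

/-- Both sides solve the same renewal equation and are bounded on `[0, u]`, so the comparison
principle applies in each direction. -/
lemma passageMoment_one_eq {u : ℝ} (hu : 0 ≤ u) :
    passageMoment r ν 1 u = ENNReal.ofReal (r * (busyMoment r ν 1).toReal * u) := by
  have hc := passageRate_pos hr hρ
  have htop := busyMoment_one_ne_top hr hν hρ
  set η := (busyMoment r ν 1).toReal with hη
  have hη0 : 0 ≤ η := ENNReal.toReal_nonneg
  have hrec : ∀ u, 0 ≤ u → ENNReal.ofReal (r * η * u) = ∫⁻ a, (if a ≤ u then busyMoment r ν 1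
      + ENNReal.ofReal (r * η * (u - a)) else 0) ∂expMeasure r := by
    intro u hu
    rw [← add_zero (r * η * u), ← zero_mul (u ^ 2),
      ← lintegral_expMeasure_poly hr (by positivity) le_rfl hu]
    refine lintegral_congr fun a => ?_
    by_cases h : a ≤ u
    · have hua : 0 ≤ u - a := sub_nonneg.2 h
      simp only [h, if_true]
      rw [← ENNReal.ofReal_toReal htop, ← hη, ← ENNReal.ofReal_add hη0 (by positivity)]
      congr 1
      field_simp
      ring
    · simp [h]
  apply le_antisymm
  · refine renewal_comparison (f := passageMoment r ν 1) (g := fun u => ENNReal.ofReal (r * η * u))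
      (G := fun _ => busyMoment r ν 1) (C := ENNReal.ofReal (passageRate r ν * u)) (by simp)
      (fun u _ _ => (passageMoment_one_renewal hr hν hρ u).le) (fun u hu _ => (hrec u hu).ge)
      (fun w hw hwu => ?_) hu le_rfl
    refine ((passageMoment_one_le hr hν hρ hw).trans (ENNReal.ofReal_le_ofReal ?_)).trans
      le_add_self
    gcongr
  · refine renewal_comparison (g := passageMoment r ν 1) (f := fun u => ENNReal.ofReal (r * η * u))
      (G := fun _ => busyMoment r ν 1) (C := ENNReal.ofReal (r * η * u)) (by simp)
      (fun u hu _ => (hrec u hu).le) (fun u _ _ => (passageMoment_one_renewal hr hν hρ u).ge)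
      (fun w hw hwu => ?_) hu le_rfl
    refine le_trans (ENNReal.ofReal_le_ofReal ?_) le_add_self
    gcongr

/-- Jensen's inequality, obtained by integrating `2 m x ≤ x ^ 2 + m ^ 2` with `m` the mean. -/
lemma sq_passageMoment_one_le {u : ℝ} (hu : 0 ≤ u) :
    passageMoment r ν 1 u ^ 2 ≤ passageMoment r ν 2 u := by
  have htop : passageMoment r ν 1 u ≠ ∞ :=
    ne_top_of_le_ne_top (by simp) (passageMoment_one_le hr hν hρ hu)
  set m := passageMoment r ν 1 u with hm
  have hpt : ∀ x : ℝ≥0∞, 2 * m * x ≤ x ^ 2 + m ^ 2 := by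
    intro x
    rcases eq_or_ne x ∞ with rfl | hx
    · simp
    · rw [← ENNReal.toReal_le_toReal (by finiteness) (by finiteness),
        ENNReal.toReal_add (by finiteness) (by finiteness)]
      simp only [ENNReal.toReal_mul, ENNReal.toReal_pow, ENNReal.toReal_ofNat]
      nlinarith [sq_nonneg (m.toReal - x.toReal)]
  have h : 2 * m * m ≤ passageMoment r ν 2 u + m ^ 2 := by
    calc 2 * m * m = ∫⁻ z, 2 * m * passage u z ∂inputLaw (expMeasure r) ν := by
          rw [lintegral_const_mul _ (by fun_prop)]
          congr 1
          simp [hm, passageMoment]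
      _ ≤ ∫⁻ z, (passage u z ^ 2 + m ^ 2) ∂inputLaw (expMeasure r) ν :=
          lintegral_mono fun z => hpt _
      _ = _ := by
          rw [lintegral_add_left (by fun_prop), lintegral_const, measure_univ, mul_one]
          rfl
  refine (ENNReal.add_le_add_iff_right (a := m ^ 2) (by finiteness)).1 ?_
  calc m ^ 2 + m ^ 2 = 2 * m * m := by ring
    _ ≤ _ := h

/-- The second moment of a busy period is finite if and only if the one of the service is. -/
lemma busyMoment_two_ne_top_iff : busyMoment r ν 2 ≠ ∞ ↔ serviceMoment ν 2 ≠ ∞ := by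
  have hη := one_le_busyMoment (r := r) (ν := ν) 1
  have hμ := serviceMoment_one_ne_top hr hρ
  have htop := busyMoment_one_ne_top hr hν hρ
  have hη1 : 1 ≤ (busyMoment r ν 1).toReal := by
    simpa using ENNReal.toReal_mono htop hη
  constructor
  · intro h hμ2
    apply h
    rw [← top_le_iff]
    -- A first service `b` generates on average `r η₁ b` further customers, so by Jensen `η₂`
    -- dominates `(r η₁) ^ 2 μ₂`.
    calc ∞ = ENNReal.ofReal ((r * (busyMoment r ν 1).toReal) ^ 2) * serviceMoment ν 2 := by
          rw [hμ2, ENNReal.mul_top]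
          have : 0 < (r * (busyMoment r ν 1).toReal) ^ 2 := by positivity
          exact (ENNReal.ofReal_pos.2 this).ne'
      _ = ∫⁻ b, ENNReal.ofReal ((r * (busyMoment r ν 1).toReal) ^ 2) * ENNReal.ofReal b ^ 2 ∂ν :=
          (lintegral_const_mul _ (by fun_prop)).symm
      _ ≤ busyMoment r ν 2 := by
          refine lintegral_mono_ae ?_
          filter_upwards [ae_nonneg_of_Iio hν] with b hb
          rw [← ENNReal.ofReal_pow hb, ← ENNReal.ofReal_mul (sq_nonneg _), ← mul_pow,
            ENNReal.ofReal_pow (by positivity), ← passageMoment_one_eq hr hν hρ hb]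
          refine (sq_passageMoment_one_le hr hν hρ hb).trans (lintegral_mono fun z => ?_)
          gcongr
          exact le_add_self
  · intro h
    obtain ⟨α, hα, hbound⟩ := exists_passageMoment_two_le hr hν hρ h
    set c := passageRate r ν
    have hle : busyMoment r ν 2 ≤ ∫⁻ b, ENNReal.ofReal (2 + (2 * α) * b + (2 * c ^ 2) * b ^ 2) ∂ν := by
      refine lintegral_mono_ae ?_
      filter_upwards [ae_nonneg_of_Iio hν] with b hb
      have hpt : ∀ x : ℝ≥0∞, (1 + x) ^ 2 ≤ 2 + 2 * x ^ 2 := by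
        intro x
        rcases eq_or_ne x ∞ with rfl | hx
        · simp
        · rw [← ENNReal.toReal_le_toReal (by finiteness) (by finiteness),
            ENNReal.toReal_add (by finiteness) (by finiteness)]
          simp only [ENNReal.toReal_mul, ENNReal.toReal_pow, ENNReal.toReal_ofNat,
            ENNReal.toReal_add ENNReal.one_ne_top hx, ENNReal.toReal_one]
          nlinarith [sq_nonneg (1 - x.toReal)]
      calc ∫⁻ z, (1 + passage b z) ^ 2 ∂inputLaw (expMeasure r) ν
          ≤ ∫⁻ z, (2 + 2 * passage b z ^ 2) ∂inputLaw (expMeasure r) ν :=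
            lintegral_mono fun z => hpt _
        _ = 2 + 2 * passageMoment r ν 2 b := by
            rw [lintegral_add_left measurable_const, lintegral_const, measure_univ, mul_one,
              lintegral_const_mul _ (by fun_prop)]
            rfl
        _ ≤ 2 + 2 * ENNReal.ofReal (α * b + c ^ 2 * b ^ 2) := by
            gcongr
            exact hbound b hb
        _ = _ := by
            rw [← ENNReal.ofReal_ofNat 2, ← ENNReal.ofReal_mul (by simp),
              ← ENNReal.ofReal_add (by simp) (by positivity)]
            ring_nf
    refine ne_top_of_le_ne_top ?_ hle
    rw [lintegral_service_poly hν (by simp) (by positivity) (by positivity)]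
    simp [ENNReal.mul_eq_top, hμ, h]

/-- The compound Poisson second moment, variance plus squared mean. Finiteness of `η₂` passes to
`μ₂`, which gives the a priori bound that the comparison needs. -/
lemma passageMoment_two_eq (h2 : busyMoment r ν 2 ≠ ∞) {u : ℝ} (hu : 0 ≤ u) :
    passageMoment r ν 2 u = ENNReal.ofReal (r * (busyMoment r ν 2).toReal * u
      + (r * (busyMoment r ν 1).toReal) ^ 2 * u ^ 2) := by
  have htop := busyMoment_one_ne_top hr hν hρ
  obtain ⟨α, hα, hbound⟩ :=
    exists_passageMoment_two_le hr hν hρ ((busyMoment_two_ne_top_iff hr hν hρ).1 h2)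
  have hrec' := passageMoment_two_renewal hr hν hρ
  have h1eq := fun u => passageMoment_one_eq (u := u) hr hν hρ
  have hη0 : 0 ≤ (busyMoment r ν 1).toReal := ENNReal.toReal_nonneg
  have hη20 : 0 ≤ (busyMoment r ν 2).toReal := ENNReal.toReal_nonneg
  set η := (busyMoment r ν 1).toReal with hη
  set η2 := (busyMoment r ν 2).toReal with hη2
  set g : ℝ → ℝ≥0∞ := fun u => ENNReal.ofReal (r * η2 * u + (r * η) ^ 2 * u ^ 2) with hg
  have hrec : ∀ u, 0 ≤ u → g u = ∫⁻ a, (if a ≤ u then (busyMoment r ν 2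
          + busyMoment r ν 1 * (2 * passageMoment r ν 1 (u - a))) + g (u - a) else 0)
        ∂expMeasure r := by
    intro u hu
    simp only [hg]
    rw [← lintegral_expMeasure_poly hr (by positivity) (by positivity) hu]
    refine lintegral_congr fun a => ?_
    by_cases h : a ≤ u
    · have hua : 0 ≤ u - a := sub_nonneg.2 h
      simp only [h, if_true]
      rw [h1eq _ hua, ← ENNReal.ofReal_toReal htop, ← ENNReal.ofReal_toReal h2, ← hη, ← hη2,
        ← ENNReal.ofReal_ofNat 2, ← ENNReal.ofReal_mul (by simp), ← ENNReal.ofReal_mul hη0,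
        ← ENNReal.ofReal_add (by positivity) (by positivity),
        ← ENNReal.ofReal_add (by positivity) (by positivity)]
      congr 1
      field_simp
      ring
    · simp [h]
  change _ = g u
  set G : ℝ → ℝ≥0∞ := fun w => busyMoment r ν 2
    + busyMoment r ν 1 * (2 * passageMoment r ν 1 w) with hG
  apply le_antisymm
  · refine renewal_comparison (r := r) (f := passageMoment r ν 2) (g := g) (G := G)
      (C := ENNReal.ofReal (α * u + passageRate r ν ^ 2 * u ^ 2)) (by simp)
      (fun u _ _ => (hrec' u).le) (fun u hu _ => (hrec u hu).ge)
      (fun w hw hwu => ?_) hu le_rfl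
    refine ((hbound w hw).trans (ENNReal.ofReal_le_ofReal ?_)).trans le_add_self
    gcongr
  · refine renewal_comparison (r := r) (g := passageMoment r ν 2) (f := g) (G := G)
      (C := g u) (by simp [hg]) (fun u hu _ => (hrec u hu).le) (fun u _ _ => (hrec' u).ge)
      (fun w hw hwu => ?_) hu le_rfl
    refine le_trans (ENNReal.ofReal_le_ofReal ?_) le_add_self
    gcongr

/-- With positive probability a customer arrives within level `u`, and the renewal equation then
contributes the infinite `η₂`. -/
lemma passageMoment_two_eq_top (h2 : busyMoment r ν 2 = ∞) {u : ℝ} (hu : 0 < u) :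
    passageMoment r ν 2 u = ∞ := by
  rw [passageMoment_two_renewal hr hν hρ, h2]
  have h : ∀ a, (if a ≤ u then (∞ + busyMoment r ν 1 * (2 * passageMoment r ν 1 (u - a)))
          + passageMoment r ν 2 (u - a) else 0) = (Set.Iic u).indicator (fun _ => ∞) a := by
    intro a
    simp [Set.indicator]
  simp only [h]
  rw [lintegral_indicator_const measurableSet_Iic, ENNReal.top_mul]
  have h1 := prob_compl_eq_one_sub (μ := expMeasure r) (measurableSet_Ioi (a := u))
  rw [Set.compl_Ioi, expMeasure_Ioi hu.le] at h1
  rw [h1]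
  have : ENNReal.ofReal (Real.exp (-(r * u))) < 1 := by
    rw [ENNReal.ofReal_lt_one, Real.exp_lt_one_iff]
    have := mul_pos hr hu
    linarith
  exact (tsub_pos_of_lt this).ne'

/-- The mixed second moments of the passage index. -/
lemma lintegral_passage_mul {u w : ℝ} (hu : 0 ≤ u) (huw : u ≤ w) :
    ∫⁻ z, passage u z * passage w z ∂inputLaw (expMeasure r) ν
      = passageMoment r ν 2 u + passageMoment r ν 1 u * passageMoment r ν 1 (w - u) := by
  have h := lintegral_passage_add hν hu (sub_nonneg.2 huw) (passage_ae_ne_top hr hν hρ hu)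
    (G := fun x y => x * y) (fun x => by fun_prop)
  rw [add_sub_cancel] at h
  rw [h]
  have h1 : ∀ z, ∫⁻ z', passage u z * (passage u z + passage (w - u) z')
      ∂inputLaw (expMeasure r) ν
      = passage u z ^ 2 + passage u z ^ 1 * passageMoment r ν 1 (w - u) := by
    intro z
    rw [lintegral_const_mul _ (by fun_prop), lintegral_add_left measurable_const, lintegral_const,
      measure_univ, mul_one, mul_add, sq, pow_one]
    simp [passageMoment]
  simp only [h1]
  rw [lintegral_add_left (by fun_prop), lintegral_mul_const _ (by fun_prop)]
  rfl

end ExactMoments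

/-! ### The externality of an input -/

/-- The externality of an input, as an integral of the passage index over the level. -/
noncomputable def levelIntegral (v x : ℝ) (z : ℕ ⊕ ℕ → ℝ) : ℝ≥0∞ :=
  ∫⁻ u in Set.Ioc v (v + x), passage u z

@[fun_prop]
lemma measurable_levelIntegral (v x : ℝ) : Measurable (levelIntegral v x) :=
  Measurable.lintegral_prod_right' (f := fun q : (ℕ ⊕ ℕ → ℝ) × ℝ => passage q.2 q.1) (by fun_prop)

lemma tsum_ofReal_externalityTerm {a b : ℕ → ℝ} (ha : ∀ n, 0 < a n) (hb : ∀ n, 0 ≤ b n) (v : ℝ)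
    {x : ℝ} (hx : 0 ≤ x) :
    ∑' n, ENNReal.ofReal (externalityTerm a b v x n) = levelIntegral v x (Sum.elim a b) := by
  simp only [ofReal_externalityTerm ha hb v hx]
  rw [← lintegral_tsum fun n => Measurable.aemeasurable (by fun_prop)]
  rfl

lemma summable_externalityTerm {a b : ℕ → ℝ} (ha : ∀ n, 0 < a n) (hb : ∀ n, 0 ≤ b n) {v x : ℝ}
    (hx : 0 ≤ x) (h : levelIntegral v x (Sum.elim a b) ≠ ∞) :
    Summable (externalityTerm a b v x) := by
  rw [← tsum_ofReal_externalityTerm ha hb v hx] at h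
  refine (ENNReal.summable_toReal h).congr fun n => ?_
  exact (ENNReal.toReal_ofReal (externalityTerm_nonneg ha hb v hx n))

lemma tsum_externalityTerm {a b : ℕ → ℝ} (ha : ∀ n, 0 < a n) (hb : ∀ n, 0 ≤ b n) {v x : ℝ}
    (hx : 0 ≤ x) (h : levelIntegral v x (Sum.elim a b) ≠ ∞) :
    ∑' n, externalityTerm a b v x n = (levelIntegral v x (Sum.elim a b)).toReal := by
  rw [← tsum_ofReal_externalityTerm ha hb v hx, ← ENNReal.ofReal_tsum_of_nonneg
    (externalityTerm_nonneg ha hb v hx) (summable_externalityTerm ha hb hx h),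
    ENNReal.toReal_ofReal (tsum_nonneg (externalityTerm_nonneg ha hb v hx))]

/-! ### Explicit integrals over an interval of levels -/

lemma integral_quadratic (p q m s t : ℝ) :
    ∫ w in s..t, (p + q * w + m * w ^ 2)
      = p * (t - s) + q * ((t ^ 2 - s ^ 2) / 2) + m * ((t ^ 3 - s ^ 3) / 3) := by
  have hder : ∀ w ∈ Set.uIcc s t, HasDerivAt
      (fun w : ℝ => p * w + q * (w ^ 2 / 2) + m * (w ^ 3 / 3)) (p + q * w + m * w ^ 2) w := by
    intro w _
    have h1 := (hasDerivAt_id w).const_mul p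
    have h2 := (((hasDerivAt_id w).pow 2).div_const 2).const_mul q
    have h3 := (((hasDerivAt_id w).pow 3).div_const 3).const_mul m
    refine ((h1.add h2).add h3).congr_deriv ?_
    simp only [id]
    norm_num
  rw [intervalIntegral.integral_eq_sub_of_hasDerivAt hder
    (Continuous.intervalIntegrable (by fun_prop) _ _)]
  ring

lemma lintegral_Ioc_ofReal {f : ℝ → ℝ} (hf : Continuous f) {s t : ℝ} (hst : s ≤ t)
    (h0 : ∀ u ∈ Set.Ioc s t, 0 ≤ f u) :
    ∫⁻ u in Set.Ioc s t, ENNReal.ofReal (f u) = ENNReal.ofReal (∫ u in s..t, f u) := by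
  rw [intervalIntegral.integral_of_le hst, ofReal_integral_eq_lintegral_ofReal]
  · exact hf.integrableOn_Ioc
  · filter_upwards [ae_restrict_mem measurableSet_Ioc] with u hu using h0 u hu

lemma lintegral_Ioc_quadratic {p q m s t : ℝ} (hst : s ≤ t)
    (h0 : ∀ u ∈ Set.Ioc s t, 0 ≤ p + q * u + m * u ^ 2) :
    ∫⁻ u in Set.Ioc s t, ENNReal.ofReal (p + q * u + m * u ^ 2) = ENNReal.ofReal
      (p * (t - s) + q * ((t ^ 2 - s ^ 2) / 2) + m * ((t ^ 3 - s ^ 3) / 3)) := by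
  rw [lintegral_Ioc_ofReal (by fun_prop) hst h0, integral_quadratic]

lemma lintegral_Ioc_min {κ d s t u : ℝ} (hκ : 0 ≤ κ) (hd : 0 ≤ d) (hs : 0 ≤ s) (hsu : s ≤ u)
    (hut : u ≤ t) :
    ∫⁻ w in Set.Ioc s t, ENNReal.ofReal (κ * min u w + d * w)
      = ENNReal.ofReal (κ * (u * t - u ^ 2 / 2 - s ^ 2 / 2) + d * ((t ^ 2 - s ^ 2) / 2)) := by
  have hu0 : 0 ≤ u := hs.trans hsu
  have hst := hsu.trans hut
  rw [lintegral_Ioc_ofReal (by fun_prop) hst]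
  · congr 1
    rw [← intervalIntegral.integral_add_adjacent_intervals (b := u)
      (Continuous.intervalIntegrable (by fun_prop) _ _)
      (Continuous.intervalIntegrable (by fun_prop) _ _),
      intervalIntegral.integral_congr (a := s) (b := u)
        (g := fun w => 0 + (κ + d) * w + 0 * w ^ 2),
      intervalIntegral.integral_congr (a := u) (b := t)
        (g := fun w => κ * u + d * w + 0 * w ^ 2), integral_quadratic, integral_quadratic]
    · ring
    · intro w hw
      rw [Set.uIcc_of_le hut] at hw
      simp only [min_eq_left hw.1]
      ring
    · intro w hw
      rw [Set.uIcc_of_le hsu] at hw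
      simp only [min_eq_right hw.2]
      ring
  · intro w hw
    have : 0 ≤ w := hs.trans hw.1.le
    have : 0 ≤ min u w := le_min hu0 this
    positivity

/-! ### First and mixed second moments of the integrated passage index -/

section LevelIntegral

variable {r : ℝ} {ν : Measure ℝ} [IsProbabilityMeasure (expMeasure r)] [IsProbabilityMeasure ν]

lemma lintegral_levelIntegral_mul_eq (v x y : ℝ) :
    ∫⁻ z, levelIntegral v x z * levelIntegral v y z ∂inputLaw (expMeasure r) ν
      = ∫⁻ u in Set.Ioc v (v + x), ∫⁻ w in Set.Ioc v (v + y),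
          ∫⁻ z, passage u z * passage w z ∂inputLaw (expMeasure r) ν := by
  have h : ∀ z, levelIntegral v x z * levelIntegral v y z
      = ∫⁻ u in Set.Ioc v (v + x), ∫⁻ w in Set.Ioc v (v + y), passage u z * passage w z := by
    intro z
    simp only [levelIntegral]
    rw [← lintegral_mul_const _ (by fun_prop)]
    refine lintegral_congr fun u => ?_
    rw [lintegral_const_mul _ (by fun_prop)]
  simp only [h]
  rw [lintegral_lintegral_swap]
  · refine lintegral_congr fun u => ?_
    rw [lintegral_lintegral_swap]
    exact Measurable.aemeasurable (by fun_prop)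
  · refine Measurable.aemeasurable ?_
    exact Measurable.lintegral_prod_right' (f := fun q : ((ℕ ⊕ ℕ → ℝ) × ℝ) × ℝ =>
      passage q.1.2 q.1.1 * passage q.2 q.1.1) (by fun_prop)

variable (hr : 0 < r) (hν : ν (Set.Iio 0) = 0) (hρ : ENNReal.ofReal r * serviceMoment ν 1 < 1)

include hr hν hρ

lemma lintegral_levelIntegral {v x : ℝ} (hv : 0 ≤ v) (hx : 0 ≤ x) :
    ∫⁻ z, levelIntegral v x z ∂inputLaw (expMeasure r) ν
      = ENNReal.ofReal (r * x * (v + x / 2) * (busyMoment r ν 1).toReal) := by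
  have hη : 0 ≤ (busyMoment r ν 1).toReal := ENNReal.toReal_nonneg
  unfold levelIntegral
  rw [lintegral_lintegral_swap (Measurable.aemeasurable (by fun_prop))]
  rw [setLIntegral_congr_fun (g := fun u => ENNReal.ofReal
    (0 + (r * (busyMoment r ν 1).toReal) * u + 0 * u ^ 2)) measurableSet_Ioc,
    lintegral_Ioc_quadratic (by linarith)]
  · congr 1
    ring
  · intro u hu
    have : 0 ≤ u := hv.trans hu.1.le
    positivity
  · intro u hu
    have := passageMoment_one_eq hr hν hρ (hv.trans hu.1.le)
    simp only [passageMoment, pow_one] at this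
    simp [this]

/-- Independent increments leave only the smaller level in the covariance `r η₂ min u w`; the rest
is the product of the means. -/
lemma lintegral_passage_mul_eq (h2 : busyMoment r ν 2 ≠ ∞) {u w : ℝ} (hu : 0 ≤ u) (hw : 0 ≤ w) :
    ∫⁻ z, passage u z * passage w z ∂inputLaw (expMeasure r) ν
      = ENNReal.ofReal (r * (busyMoment r ν 2).toReal * min u w
        + ((r * (busyMoment r ν 1).toReal) ^ 2 * u) * w) := by
  have hη : 0 ≤ (busyMoment r ν 1).toReal := ENNReal.toReal_nonneg
  have hη2 : 0 ≤ (busyMoment r ν 2).toReal := ENNReal.toReal_nonneg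
  wlog huw : u ≤ w generalizing u w
  · simp only [mul_comm (passage u _)]
    rw [this hw hu (not_le.1 huw).le, min_comm]
    congr 1
    ring
  · have hwu : 0 ≤ w - u := sub_nonneg.2 huw
    rw [lintegral_passage_mul hr hν hρ hu huw, passageMoment_two_eq hr hν hρ h2 hu,
      passageMoment_one_eq hr hν hρ hu, passageMoment_one_eq hr hν hρ hwu,
      ← ENNReal.ofReal_mul (by positivity), ← ENNReal.ofReal_add (by positivity) (by positivity),
      min_eq_left huw]
    congr 1
    ring

lemma lintegral_levelIntegral_mul (h2 : busyMoment r ν 2 ≠ ∞) {v x₁ x₂ : ℝ} (hv : 0 ≤ v)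
    (hx₁ : 0 ≤ x₁) (hx₂ : 0 ≤ x₂) :
    ∫⁻ z, levelIntegral v x₁ z * levelIntegral v (x₁ + x₂) z ∂inputLaw (expMeasure r) ν
      = ENNReal.ofReal (r * (busyMoment r ν 2).toReal / 6
          * (2 * x₁ ^ 3 + 6 * v * x₁ ^ 2 + 3 * x₁ ^ 2 * x₂ + 6 * v * x₁ * x₂)
        + (r * x₁ * (v + x₁ / 2) * (busyMoment r ν 1).toReal)
          * (r * (x₁ + x₂) * (v + (x₁ + x₂) / 2) * (busyMoment r ν 1).toReal)) := by
  have hη : 0 ≤ (busyMoment r ν 1).toReal := ENNReal.toReal_nonneg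
  have hη2 : 0 ≤ (busyMoment r ν 2).toReal := ENNReal.toReal_nonneg
  rw [lintegral_levelIntegral_mul_eq]
  have hmul := fun u w => lintegral_passage_mul_eq (u := u) (w := w) hr hν hρ h2
  set η := (busyMoment r ν 1).toReal
  set η2 := (busyMoment r ν 2).toReal
  obtain ⟨t, ht⟩ : ∃ t, t = v + (x₁ + x₂) := ⟨_, rfl⟩
  rw [← ht]
  have hinner : ∀ u ∈ Set.Ioc v (v + x₁), ∫⁻ w in Set.Ioc v t,
      ∫⁻ z, passage u z * passage w z ∂inputLaw (expMeasure r) ν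
      = ENNReal.ofReal (-(r * η2 * v ^ 2 / 2) + (r * η2 * t + (r * η) ^ 2 * ((t ^ 2 - v ^ 2) / 2)) * u
        + -(r * η2 / 2) * u ^ 2) := by
    intro u hu
    have hu0 : 0 ≤ u := hv.trans hu.1.le
    rw [setLIntegral_congr_fun measurableSet_Ioc
      fun w (hw : w ∈ Set.Ioc v t) => hmul u w hu0 (hv.trans hw.1.le),
      lintegral_Ioc_min (by positivity) (by positivity) hv hu.1.le (by linarith [hu.2])]
    congr 1
    ring
  rw [setLIntegral_congr_fun measurableSet_Ioc hinner, lintegral_Ioc_quadratic (by linarith)]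
  · congr 1
    rw [ht]
    ring
  · intro u hu
    have h1 : 0 ≤ u - v := sub_nonneg.2 hu.1.le
    have h2 : 0 ≤ t - u := by linarith [hu.2]
    have h3 : 0 ≤ u := hv.trans hu.1.le
    have h4 : 0 ≤ t ^ 2 - v ^ 2 := by nlinarith
    have h5 : 0 ≤ (u - v) * (t - v) := mul_nonneg h1 (by linarith)
    -- The quadratic has a nonpositive leading coefficient, so it is rewritten through the
    -- nonnegative quantities `u - v` and `t - u`.
    calc 0 ≤ r * η2 * (v * (u - v) / 2 + (u * (t - u)) + u * (u - v) / 2)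
          + (r * η) ^ 2 * ((t ^ 2 - v ^ 2) / 2) * u := by positivity
      _ = _ := by ring

lemma lintegral_levelIntegral_sq_eq_top (h2 : busyMoment r ν 2 = ∞) {v x : ℝ} (hv : 0 ≤ v)
    (hx : 0 < x) :
    ∫⁻ z, levelIntegral v x z * levelIntegral v x z ∂inputLaw (expMeasure r) ν = ∞ := by
  rw [lintegral_levelIntegral_mul_eq]
  have h : ∀ u, 0 < u → ∀ w, 0 < w →
      ∫⁻ z, passage u z * passage w z ∂inputLaw (expMeasure r) ν = ∞ := by
    intro u hu w hw
    wlog huw : u ≤ w generalizing u w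
    · simp only [mul_comm (passage u _)]
      exact this w hw u hu (not_le.1 huw).le
    · rw [lintegral_passage_mul hr hν hρ hu.le huw, passageMoment_two_eq_top hr hν hρ h2 hu,
        top_add]
  have hpos : volume (Set.Ioc v (v + x)) ≠ 0 := by
    simpa using hx
  have hinner : ∀ u ∈ Set.Ioc v (v + x), ∫⁻ w in Set.Ioc v (v + x),
      ∫⁻ z, passage u z * passage w z ∂inputLaw (expMeasure r) ν = ∞ := by
    intro u hu
    rw [setLIntegral_congr_fun measurableSet_Ioc
      fun w (hw : w ∈ Set.Ioc v (v + x)) => h u (hv.trans_lt hu.1) w (hv.trans_lt hw.1),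
      setLIntegral_const, ENNReal.top_mul hpos]
  rw [setLIntegral_congr_fun measurableSet_Ioc hinner, setLIntegral_const, ENNReal.top_mul hpos]

end LevelIntegral

/-! ### The stochastic model -/

namespace IsStableInput

variable {Ω : Type*} [MeasurableSpace Ω] {P : Measure Ω} [IsProbabilityMeasure P] {rate : ℝ}
  {ν : Measure ℝ} {A B : ℕ → Ω → ℝ}

/-- The input as a random sequence. -/
def input (A B : ℕ → Ω → ℝ) (ω : Ω) : ℕ ⊕ ℕ → ℝ := Sum.elim (fun n => A n ω) fun n => B n ω

omit [IsProbabilityMeasure P] in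
lemma isProbabilityMeasure_exp (hQ : IsStableInput P rate ν A B) :
    IsProbabilityMeasure (expMeasure rate) := isProbabilityMeasure_expMeasure hQ.rate_pos

lemma isProbabilityMeasure_service (hQ : IsStableInput P rate ν A B) : IsProbabilityMeasure ν := by
  rw [← hQ.law_service 0]
  exact Measure.isProbabilityMeasure_map (hQ.measurable_service 0).aemeasurable

variable [IsProbabilityMeasure (expMeasure rate)] [IsProbabilityMeasure ν]
  (hQ : IsStableInput P rate ν A B)

include hQ

omit [IsProbabilityMeasure P] in
lemma measurePreserving_input :
    MeasurePreserving (input A B) P (inputLaw (expMeasure rate) ν) := by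
  have hm : ∀ i, Measurable (Sum.elim A B i) := by
    rintro (i | i)
    · exact hQ.measurable_interarrival i
    · exact hQ.measurable_service i
  have h := hQ.indep.map_fun_eq_infinitePi_map hm
  have h1 : (fun ω i => Sum.elim A B i ω) = input A B := by
    funext ω i
    cases i <;> rfl
  have h2 : (fun i => P.map (Sum.elim A B i))
      = Sum.elim (fun _ => expMeasure rate) fun _ => ν := by
    funext i
    cases i with
    | inl i => exact hQ.law_interarrival i
    | inr i => exact hQ.law_service i
  refine ⟨by rw [← h1]; exact measurable_pi_lambda _ hm, ?_⟩
  rw [h1] at h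
  rw [h, inputLaw]
  congr 1

omit [IsProbabilityMeasure P] [IsProbabilityMeasure (expMeasure rate)]
  [IsProbabilityMeasure ν] in
lemma ae_interarrival_pos : ∀ᵐ ω ∂P, ∀ n, 0 < A n ω := by
  rw [ae_all_iff]
  intro n
  have h := ae_pos_expMeasure (r := rate)
  rw [← hQ.law_interarrival n] at h
  exact ae_of_ae_map (hQ.measurable_interarrival n).aemeasurable h

omit [IsProbabilityMeasure P] [IsProbabilityMeasure (expMeasure rate)]
  [IsProbabilityMeasure ν] in
lemma ae_service_nonneg : ∀ᵐ ω ∂P, ∀ n, 0 ≤ B n ω := by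
  rw [ae_all_iff]
  intro n
  have h := ae_nonneg_of_Iio hQ.service_nonneg
  rw [← hQ.law_service n] at h
  exact ae_of_ae_map (hQ.measurable_service n).aemeasurable h

omit [IsProbabilityMeasure P] in
/-- The moments of the passage index over the first interarrival time. -/
lemma lintegral_passage_first (k : ℕ) :
    ∫⁻ ω, passage (A 0 ω) (input A B ω) ^ k ∂P = busyMoment rate ν k := by
  have h1 := hQ.measurePreserving_input.lintegral_comp
    (f := fun z => passage (z (.inl 0)) z ^ k) (by fun_prop)
  have h2 : ∀ ω, passage (A 0 ω) (input A B ω) ^ k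
      = passage (input A B ω (.inl 0)) (input A B ω) ^ k := fun ω => rfl
  simp only [h2]
  rw [h1, lintegral_inputLaw (f := fun z => passage (z (.inl 0)) z ^ k) (by fun_prop)]
  -- With level equal to the first interarrival time, the first customer is always counted and the
  -- remaining level is exactly that customer's service `b`.
  have h3 : ∀ (a b : ℝ) (z : ℕ ⊕ ℕ → ℝ),
      passage (consInput (a, b, z) (.inl 0)) (consInput (a, b, z)) ^ k = (1 + passage b z) ^ k := by
    intro a b z
    rw [passage_consInput]
    simp [consInput]
  simp only [h3]
  rw [lintegral_const, measure_univ, mul_one, busyMoment]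

omit [IsProbabilityMeasure P] in
lemma ae_passage_first_ne_top : ∀ᵐ ω ∂P, passage (A 0 ω) (input A B ω) ≠ ∞ := by
  have h := hQ.lintegral_passage_first 1
  have htop := busyMoment_one_ne_top hQ.rate_pos hQ.service_nonneg hQ.load_lt_one
  rw [← h] at htop
  simp only [pow_one] at htop
  have hm : Measurable fun ω => passage (A 0 ω) (input A B ω) :=
    (hQ.measurable_interarrival 0).mg1_passage hQ.measurePreserving_input.measurable
  filter_upwards [ae_lt_top hm htop] with ω hω using hω.ne

omit [IsProbabilityMeasure P] in
-- The busy period count is almost surely the passage index at the level of the first interarrival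
-- time, so the moment series is an integral decomposed by values. The value zero does not occur,
-- hence the shift by one loses nothing.
lemma busyPeriodMoment_eq (k : ℕ) : busyPeriodMoment P A B k = busyMoment rate ν k := by
  rw [← hQ.lintegral_passage_first k, busyPeriodMoment]
  have hm : Measurable fun ω => passage (A 0 ω) (input A B ω) :=
    (hQ.measurable_interarrival 0).mg1_passage hQ.measurePreserving_input.measurable
  have hset : ∀ s : ℕ, MeasurableSet {ω | passage (A 0 ω) (input A B ω) = (s + 1 : ℕ)} := fun s =>
    measurableSet_eq_fun hm measurable_const
  have hae : ∀ᵐ ω ∂P, ∃ n : ℕ, 1 ≤ n ∧ passage (A 0 ω) (input A B ω) = n ∧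
      firstBusyPeriodCount (fun i => A i ω) (fun i => B i ω) = n := by
    filter_upwards [hQ.ae_interarrival_pos, hQ.ae_service_nonneg, hQ.ae_passage_first_ne_top]
      with ω ha hb hfin using firstBusyPeriodCount_eq ha hb hfin
  have hprob : ∀ s : ℕ, busyPeriodProb P A B (s + 1)
      = P {ω | passage (A 0 ω) (input A B ω) = (s + 1 : ℕ)} := by
    intro s
    refine measure_congr ?_
    filter_upwards [hae] with ω hω
    obtain ⟨n, -, h1, h2⟩ := hω
    refine propext ?_
    change firstBusyPeriodCount _ _ = ((s + 1 : ℕ) : ℕ∞) ↔ passage _ _ = ((s + 1 : ℕ) : ℝ≥0∞)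
    rw [h1, h2, Nat.cast_inj, Nat.cast_inj]
  have hterm : ∀ s : ℕ, ((s + 1 : ℕ) : ℝ≥0∞) ^ k * busyPeriodProb P A B (s + 1)
      = ∫⁻ ω, {ω | passage (A 0 ω) (input A B ω) = (s + 1 : ℕ)}.indicator
        (fun _ => ((s + 1 : ℕ) : ℝ≥0∞) ^ k) ω ∂P := by
    intro s
    rw [lintegral_indicator_const (hset s), hprob]
  simp only [hterm]
  rw [← lintegral_tsum fun s => (measurable_const.indicator (hset s)).aemeasurable]
  refine lintegral_congr_ae ?_
  filter_upwards [hae] with ω hω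
  obtain ⟨n, hn, h1, -⟩ := hω
  obtain ⟨m, rfl⟩ : ∃ m, n = m + 1 := ⟨n - 1, by omega⟩
  rw [tsum_eq_single m]
  · rw [Set.indicator_of_mem (by exact h1), h1]
  · intro s hs
    refine Set.indicator_of_notMem ?_ _
    change ¬ passage _ _ = _
    rw [h1, Nat.cast_inj]
    omega

omit [IsProbabilityMeasure P] in
lemma lintegral_levelIntegral_input {v x : ℝ} (hv : 0 ≤ v) (hx : 0 ≤ x) :
    ∫⁻ ω, levelIntegral v x (input A B ω) ∂P
      = ENNReal.ofReal (rate * x * (v + x / 2) * (busyPeriodMoment P A B 1).toReal) := by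
  rw [hQ.measurePreserving_input.lintegral_comp (by fun_prop), hQ.busyPeriodMoment_eq,
    lintegral_levelIntegral hQ.rate_pos hQ.service_nonneg hQ.load_lt_one hv hx]

omit [IsProbabilityMeasure P] in
lemma measurable_levelIntegral_input (v x : ℝ) :
    Measurable fun ω => levelIntegral v x (input A B ω) :=
  (measurable_levelIntegral v x).comp hQ.measurePreserving_input.measurable

omit [IsProbabilityMeasure P] in
lemma ae_levelIntegral_ne_top {v x : ℝ} (hv : 0 ≤ v) (hx : 0 ≤ x) :
    ∀ᵐ ω ∂P, levelIntegral v x (input A B ω) ≠ ∞ := by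
  have h : ∫⁻ ω, levelIntegral v x (input A B ω) ∂P ≠ ∞ := by
    rw [hQ.lintegral_levelIntegral_input hv hx]
    simp
  filter_upwards [ae_lt_top (hQ.measurable_levelIntegral_input v x) h] with ω hω using hω.ne

omit [IsProbabilityMeasure P] in
lemma ae_summable {v x : ℝ} (hv : 0 ≤ v) (hx : 0 ≤ x) :
    ∀ᵐ ω ∂P, Summable (externalityTerm (fun i => A i ω) (fun i => B i ω) v x) := by
  filter_upwards [hQ.ae_interarrival_pos, hQ.ae_service_nonneg, hQ.ae_levelIntegral_ne_top hv hx]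
    with ω ha hb hfin using summable_externalityTerm ha hb hx hfin

omit [IsProbabilityMeasure P] in
lemma externality_ae_eq {v x : ℝ} (hv : 0 ≤ v) (hx : 0 ≤ x) :
    externality A B v x =ᵐ[P] fun ω => (levelIntegral v x (input A B ω)).toReal := by
  filter_upwards [hQ.ae_interarrival_pos, hQ.ae_service_nonneg, hQ.ae_levelIntegral_ne_top hv hx]
    with ω ha hb hfin using tsum_externalityTerm ha hb hx hfin

omit [IsProbabilityMeasure P] in
lemma integrable_externality {v x : ℝ} (hv : 0 ≤ v) (hx : 0 ≤ x) :
    Integrable (externality A B v x) P := by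
  refine Integrable.congr ?_ (hQ.externality_ae_eq hv hx).symm
  refine integrable_toReal_of_lintegral_ne_top
    (hQ.measurable_levelIntegral_input v x).aemeasurable ?_
  rw [hQ.lintegral_levelIntegral_input hv hx]
  simp

omit [IsProbabilityMeasure P] in
lemma integral_externality {v x : ℝ} (hv : 0 ≤ v) (hx : 0 ≤ x) :
    ∫ ω, externality A B v x ω ∂P
      = rate * x * (v + x / 2) * (busyPeriodMoment P A B 1).toReal := by
  have := hQ.rate_pos
  have h1 : 0 ≤ (busyPeriodMoment P A B 1).toReal := ENNReal.toReal_nonneg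
  rw [integral_congr_ae (hQ.externality_ae_eq hv hx), integral_toReal
    (hQ.measurable_levelIntegral_input v x).aemeasurable, hQ.lintegral_levelIntegral_input hv hx,
    ENNReal.toReal_ofReal (by positivity)]
  filter_upwards [hQ.ae_levelIntegral_ne_top hv hx] with ω hω using hω.lt_top

omit [IsProbabilityMeasure P] in
/-- The mixed second moments of the externality. -/
lemma lintegral_levelIntegral_mul_input (h2 : busyPeriodMoment P A B 2 ≠ ∞) {v x₁ x₂ : ℝ}
    (hv : 0 ≤ v) (hx₁ : 0 ≤ x₁) (hx₂ : 0 ≤ x₂) :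
    ∫⁻ ω, levelIntegral v x₁ (input A B ω) * levelIntegral v (x₁ + x₂) (input A B ω) ∂P
      = ENNReal.ofReal (rate * (busyPeriodMoment P A B 2).toReal / 6
          * (2 * x₁ ^ 3 + 6 * v * x₁ ^ 2 + 3 * x₁ ^ 2 * x₂ + 6 * v * x₁ * x₂)
        + (rate * x₁ * (v + x₁ / 2) * (busyPeriodMoment P A B 1).toReal)
          * (rate * (x₁ + x₂) * (v + (x₁ + x₂) / 2) * (busyPeriodMoment P A B 1).toReal)) := by
  rw [hQ.busyPeriodMoment_eq] at h2
  rw [hQ.measurePreserving_input.lintegral_comp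
    (f := fun z => levelIntegral v x₁ z * levelIntegral v (x₁ + x₂) z) (by fun_prop),
    hQ.busyPeriodMoment_eq, hQ.busyPeriodMoment_eq,
    lintegral_levelIntegral_mul hQ.rate_pos hQ.service_nonneg hQ.load_lt_one h2 hv hx₁ hx₂]

omit [IsProbabilityMeasure P] in
-- Stated in extended numbers so that it yields square integrability when `η₂` is finite and its
-- failure when `η₂` is infinite.
lemma eLpNorm_externality_sq {v x : ℝ} (hv : 0 ≤ v) (hx : 0 ≤ x) :
    eLpNorm (externality A B v x) 2 P ^ 2
      = ∫⁻ ω, levelIntegral v x (input A B ω) * levelIntegral v x (input A B ω) ∂P := by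
  have h := eLpNorm_nnreal_pow_eq_lintegral (μ := P) (p := 2)
    (f := fun ω => (levelIntegral v x (input A B ω)).toReal) two_ne_zero
  simp only [NNReal.coe_ofNat, ENNReal.coe_ofNat, ENNReal.rpow_ofNat] at h
  rw [eLpNorm_congr_ae (hQ.externality_ae_eq hv hx), h]
  refine lintegral_congr_ae ?_
  filter_upwards [hQ.ae_levelIntegral_ne_top hv hx] with ω hω
  rw [Real.enorm_of_nonneg ENNReal.toReal_nonneg, ENNReal.ofReal_toReal hω, sq]

omit [IsProbabilityMeasure P] in
lemma memLp_externality (h2 : busyPeriodMoment P A B 2 ≠ ∞) {v x : ℝ} (hv : 0 ≤ v) (hx : 0 ≤ x) :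
    MemLp (externality A B v x) 2 P := by
  refine ⟨(hQ.integrable_externality hv hx).aestronglyMeasurable, ?_⟩
  refine (ENNReal.pow_lt_top_iff.1 ?_).resolve_right two_ne_zero
  rw [hQ.eLpNorm_externality_sq hv hx]
  have := hQ.lintegral_levelIntegral_mul_input h2 hv hx le_rfl
  rw [add_zero] at this
  rw [this]
  exact ENNReal.ofReal_lt_top

lemma covariance_externality (h2 : busyPeriodMoment P A B 2 ≠ ∞) {v x₁ x₂ : ℝ}
    (hv : 0 ≤ v) (hx₁ : 0 ≤ x₁) (hx₂ : 0 ≤ x₂) :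
    covariance (externality A B v (x₁ + x₂)) (externality A B v x₁) P
      = rate * (busyPeriodMoment P A B 2).toReal / 6
          * (2 * x₁ ^ 3 + 6 * v * x₁ ^ 2 + 3 * x₁ ^ 2 * x₂ + 6 * v * x₁ * x₂) := by
  have hr := hQ.rate_pos
  have hx : 0 ≤ x₁ + x₂ := by positivity
  have h1 : 0 ≤ (busyPeriodMoment P A B 1).toReal := ENNReal.toReal_nonneg
  have h1' : 0 ≤ (busyPeriodMoment P A B 2).toReal := ENNReal.toReal_nonneg
  have hmul := hQ.lintegral_levelIntegral_mul_input h2 hv hx₁ hx₂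
  have hprod : ∫ ω, (externality A B v (x₁ + x₂) * externality A B v x₁) ω ∂P
      = rate * (busyPeriodMoment P A B 2).toReal / 6
          * (2 * x₁ ^ 3 + 6 * v * x₁ ^ 2 + 3 * x₁ ^ 2 * x₂ + 6 * v * x₁ * x₂)
        + (rate * x₁ * (v + x₁ / 2) * (busyPeriodMoment P A B 1).toReal)
          * (rate * (x₁ + x₂) * (v + (x₁ + x₂) / 2) * (busyPeriodMoment P A B 1).toReal) := by
    have hae : externality A B v (x₁ + x₂) * externality A B v x₁ =ᵐ[P] fun ω =>
        (levelIntegral v x₁ (input A B ω) * levelIntegral v (x₁ + x₂) (input A B ω)).toReal := by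
      filter_upwards [hQ.externality_ae_eq hv hx₁, hQ.externality_ae_eq hv hx] with ω e1 e2
      rw [Pi.mul_apply, e1, e2, ENNReal.toReal_mul, mul_comm]
    rw [integral_congr_ae hae, integral_toReal, hmul, ENNReal.toReal_ofReal (by positivity)]
    · exact ((hQ.measurable_levelIntegral_input v x₁).mul
        (hQ.measurable_levelIntegral_input v (x₁ + x₂))).aemeasurable
    · filter_upwards [hQ.ae_levelIntegral_ne_top hv hx₁, hQ.ae_levelIntegral_ne_top hv hx]
        with ω e1 e2 using ENNReal.mul_lt_top e1.lt_top e2.lt_top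
  rw [covariance_eq_sub (hQ.memLp_externality h2 hv hx) (hQ.memLp_externality h2 hv hx₁), hprod,
    hQ.integral_externality hv hx₁, hQ.integral_externality hv hx]
  ring

lemma variance_externality (h2 : busyPeriodMoment P A B 2 ≠ ∞) {v x : ℝ} (hv : 0 ≤ v)
    (hx : 0 ≤ x) : variance (externality A B v x) P
      = rate * x ^ 2 * (v + x / 3) * (busyPeriodMoment P A B 2).toReal := by
  have h := hQ.covariance_externality h2 hv hx le_rfl
  rw [add_zero, covariance_self (hQ.memLp_externality h2 hv hx).aemeasurable] at h
  rw [h]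
  ring

lemma evariance_externality {v x : ℝ} (hv : 0 ≤ v) (hx : 0 ≤ x) :
    evariance (externality A B v x) P
      = ENNReal.ofReal (rate * x ^ 2 * (v + x / 3)) * busyPeriodMoment P A B 2 := by
  have hr := hQ.rate_pos
  by_cases h2 : busyPeriodMoment P A B 2 = ∞
  -- For `x = 0` the externality vanishes identically, in accordance with `0 * ∞ = 0`; for `x > 0`
  -- the second moment is infinite.
  · rcases hx.eq_or_lt with rfl | hx'
    · have h0 : externality A B v 0 = 0 := by
        funext ω
        simp [externality, externalityTerm]
      simp [h0]
    · rw [h2, ENNReal.mul_top (ENNReal.ofReal_pos.2 (by positivity)).ne']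
      refine evariance_eq_top (hQ.integrable_externality hv hx).aestronglyMeasurable fun hmem => ?_
      have h := hQ.eLpNorm_externality_sq hv hx
      rw [hQ.busyPeriodMoment_eq] at h2
      rw [hQ.measurePreserving_input.lintegral_comp
        (f := fun z => levelIntegral v x z * levelIntegral v x z) (by fun_prop),
        lintegral_levelIntegral_sq_eq_top hQ.rate_pos hQ.service_nonneg hQ.load_lt_one h2 hv hx'] at h
      exact ENNReal.pow_ne_top hmem.eLpNorm_ne_top h
  · rw [← (hQ.memLp_externality h2 hv hx).ofReal_variance_eq, hQ.variance_externality h2 hv hx,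
      ENNReal.ofReal_mul (by positivity), ENNReal.ofReal_toReal h2]

omit [IsProbabilityMeasure P] in
lemma busyPeriodMoment_two_pos (h2 : busyPeriodMoment P A B 2 ≠ ∞) :
    0 < (busyPeriodMoment P A B 2).toReal := by
  refine ENNReal.toReal_pos ?_ h2
  rw [hQ.busyPeriodMoment_eq]
  exact (zero_lt_one.trans_le (one_le_busyMoment 2)).ne'

lemma variance_externality_pos (h2 : busyPeriodMoment P A B 2 ≠ ∞) {v x : ℝ} (hv : 0 ≤ v)
    (hx : 0 < x) : 0 < variance (externality A B v x) P := by
  have hr := hQ.rate_pos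
  have := hQ.busyPeriodMoment_two_pos h2
  rw [hQ.variance_externality h2 hv hx.le]
  positivity

/-- Covariance and variances all carry the factor `rate * η₂`, which is positive and finite and
cancels; no trace of the queue remains. -/
lemma correlation_externality (h2 : busyPeriodMoment P A B 2 ≠ ∞) {v x₁ x₂ : ℝ} (hv : 0 ≤ v)
    (hx₁ : 0 < x₁) (hx₂ : 0 ≤ x₂) :
    correlation (externality A B v (x₁ + x₂)) (externality A B v x₁) P
      = (2 * x₁ ^ 3 + 6 * v * x₁ ^ 2 + 3 * x₁ ^ 2 * x₂ + 6 * v * x₁ * x₂)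
        / (6 * x₁ * (x₁ + x₂) * √((v + x₁ / 3) * (v + (x₁ + x₂) / 3))) := by
  have hr := hQ.rate_pos
  have hη := hQ.busyPeriodMoment_two_pos h2
  rw [correlation, hQ.covariance_externality h2 hv hx₁.le hx₂, hQ.variance_externality h2 hv hx₁.le,
    hQ.variance_externality h2 hv (by positivity)]
  set η := (busyPeriodMoment P A B 2).toReal
  have hx : 0 < x₁ + x₂ := by positivity
  have hp : 0 < (v + x₁ / 3) * (v + (x₁ + x₂) / 3) := by positivity
  have hs : √(rate * (x₁ + x₂) ^ 2 * (v + (x₁ + x₂) / 3) * η) * √(rate * x₁ ^ 2 * (v + x₁ / 3) * η)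
      = rate * η * (x₁ * (x₁ + x₂)) * √((v + x₁ / 3) * (v + (x₁ + x₂) / 3)) := by
    rw [← Real.sqrt_mul (by positivity), ← Real.sqrt_sq (by positivity : 0 ≤ rate * η * (x₁ * (x₁ + x₂))),
      ← Real.sqrt_mul (by positivity)]
    congr 1
    ring
  rw [hs]
  have hsq : 0 < √((v + x₁ / 3) * (v + (x₁ + x₂) / 3)) := Real.sqrt_pos.2 hp
  field_simp

omit [IsProbabilityMeasure P] in
lemma busyPeriodMoment_one_lt_top : busyPeriodMoment P A B 1 < ∞ := by
  rw [hQ.busyPeriodMoment_eq]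
  exact (busyMoment_one_ne_top hQ.rate_pos hQ.service_nonneg hQ.load_lt_one).lt_top

omit [IsProbabilityMeasure P] in
lemma busyPeriodMoment_two_ne_top (h : serviceMoment ν 2 < ∞) : busyPeriodMoment P A B 2 ≠ ∞ := by
  rw [hQ.busyPeriodMoment_eq]
  exact (busyMoment_two_ne_top_iff hQ.rate_pos hQ.service_nonneg hQ.load_lt_one).2 h.ne

end IsStableInput

end MG1

theorem mainTheorem7 {Ω : Type*} [MeasurableSpace Ω] (P : Measure Ω) [IsProbabilityMeasure P]
    (rate : ℝ) (ν : Measure ℝ) (A B : ℕ → Ω → ℝ) (hQ : MG1.IsStableInput P rate ν A B)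
    (v : ℝ) (hv : 0 ≤ v) :
    -- the externality is well defined: its series converges almost surely
    (∀ x : ℝ, 0 ≤ x → ∀ᵐ ω ∂P,
      Summable (MG1.externalityTerm (fun i => A i ω) (fun i => B i ω) v x)) ∧
    -- expectation
    MG1.busyPeriodMoment P A B 1 < ∞ ∧
    (∀ x : ℝ, 0 ≤ x →
      Integrable (MG1.externality A B v x) P ∧
      ∫ ω, MG1.externality A B v x ω ∂P
        = rate * x * (v + x / 2) * (MG1.busyPeriodMoment P A B 1).toReal) ∧
    -- variance, as an identity between extended nonnegative numbers
    (∀ x : ℝ, 0 ≤ x →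
      evariance (MG1.externality A B v x) P
        = ENNReal.ofReal (rate * x ^ 2 * (v + x / 3)) * MG1.busyPeriodMoment P A B 2) ∧
    -- auto-covariance and auto-correlation, for service times with a finite second moment
    (MG1.serviceMoment ν 2 < ∞ →
      MG1.busyPeriodMoment P A B 2 < ∞ ∧
      (∀ x : ℝ, 0 ≤ x → MemLp (MG1.externality A B v x) 2 P ∧
        variance (MG1.externality A B v x) P
          = rate * x ^ 2 * (v + x / 3) * (MG1.busyPeriodMoment P A B 2).toReal) ∧
      (∀ x₁ x₂ : ℝ, 0 ≤ x₁ → 0 ≤ x₂ →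
        covariance (MG1.externality A B v (x₁ + x₂)) (MG1.externality A B v x₁) P
          = rate * (MG1.busyPeriodMoment P A B 2).toReal / 6
            * (2 * x₁ ^ 3 + 6 * v * x₁ ^ 2 + 3 * x₁ ^ 2 * x₂ + 6 * v * x₁ * x₂)) ∧
      (∀ x₁ x₂ : ℝ, 0 < x₁ → 0 ≤ x₂ →
        0 < variance (MG1.externality A B v x₁) P ∧
        0 < variance (MG1.externality A B v (x₁ + x₂)) P ∧
        MG1.correlation (MG1.externality A B v (x₁ + x₂)) (MG1.externality A B v x₁) P
          = (2 * x₁ ^ 3 + 6 * v * x₁ ^ 2 + 3 * x₁ ^ 2 * x₂ + 6 * v * x₁ * x₂)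
            / (6 * x₁ * (x₁ + x₂) * √((v + x₁ / 3) * (v + (x₁ + x₂) / 3)))) ∧
      -- the auto-correlation is the same for every arrival rate and service distribution
      (∀ {Ω' : Type*} [MeasurableSpace Ω'] (P' : Measure Ω') [IsProbabilityMeasure P']
        (rate' : ℝ) (ν' : Measure ℝ) (A' B' : ℕ → Ω' → ℝ),
        MG1.IsStableInput P' rate' ν' A' B' → MG1.serviceMoment ν' 2 < ∞ →
        ∀ x₁ x₂ : ℝ, 0 < x₁ → 0 ≤ x₂ →
          MG1.correlation (MG1.externality A' B' v (x₁ + x₂)) (MG1.externality A' B' v x₁) P'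
            = MG1.correlation (MG1.externality A B v (x₁ + x₂))
                (MG1.externality A B v x₁) P)) := by
  have := hQ.isProbabilityMeasure_exp
  have := hQ.isProbabilityMeasure_service
  refine ⟨fun x hx => hQ.ae_summable hv hx, hQ.busyPeriodMoment_one_lt_top,
    fun x hx => ⟨hQ.integrable_externality hv hx, hQ.integral_externality hv hx⟩,
    fun x hx => hQ.evariance_externality hv hx, fun hμ => ?_⟩
  have h2 := hQ.busyPeriodMoment_two_ne_top hμ
  refine ⟨h2.lt_top,
    fun x hx => ⟨hQ.memLp_externality h2 hv hx, hQ.variance_externality h2 hv hx⟩,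
    fun x₁ x₂ hx₁ hx₂ => hQ.covariance_externality h2 hv hx₁ hx₂,
    fun x₁ x₂ hx₁ hx₂ => ⟨hQ.variance_externality_pos h2 hv hx₁,
      hQ.variance_externality_pos h2 hv (by positivity),
      hQ.correlation_externality h2 hv hx₁ hx₂⟩, ?_⟩
  intro Ω' _ P' _ rate' ν' A' B' hQ' hμ' x₁ x₂ hx₁ hx₂
  have := hQ'.isProbabilityMeasure_exp
  have := hQ'.isProbabilityMeasure_service
  rw [hQ.correlation_externality h2 hv hx₁ hx₂,
    hQ'.correlation_externality (hQ'.busyPeriodMoment_two_ne_top hμ') hv hx₁ hx₂]
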